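/- Let $\theta,\rho$ be real numbers with $|\theta|<1$ and $|\rho|<1$. Let $(V_n)_{n\ge 1}$ be independent and identically distributed real random variables with mean zero, variance $\sigma^2>0$ and a finite moment of order $4$. Let $X_0$ and $\varepsilon_0$ be arbitrary real random variables on the same probability space and, for all $n\ge 1$, let $$X_n=\theta X_{n-1}+\varepsilon_n,\qquad \varepsilon_n=\rho\,\varepsilon_{n-1}+V_n .$$ For $n\ge 1$ put $$\widehat\theta_n=\frac{\sum_{k=1}^n X_kX_{k-1}}{\sum_{k=1}^n X_{k-1}^2},\qquad \widehat\rho_n=\frac{\sum_{k=1}^n \widehat\varepsilon_k\,\widehat\varepsilon_{k-1}}{\sum_{k=1}^n \widehat\varepsilon_{k-1}^{\,2}},$$ where $\widehat\varepsilon_0=X_0$ and $\widehat\varepsilon_k=X_k-\widehat\theta_nX_{k-1}$ for $1\le k\le n$ (a quotient with zero denominator is given the value $0$). Put $$\theta^*=\frac{\theta+\rho}{1+\theta\rho},\qquad \rho^*=\theta\rho\,\theta^*,\qquad \sigma_\theta^2=\frac{(1-\theta^2)(1-\theta\rho)(1-\rho^2)}{(1+\theta\rho)^3},$$ $$\sigma_\rho^2=\frac{1-\theta\rho}{(1+\theta\rho)^3}\Big((\theta+\rho)^2(1+\theta\rho)^2+(\theta\rho)^2(1-\theta^2)(1-\rho^2)\Big),\qquad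 \Gamma=\begin{pmatrix}\sigma_\theta^2&\theta\rho\,\sigma_\theta^2\\ \theta\rho\,\sigma_\theta^2&\sigma_\rho^2\end{pmatrix}.$$ Then $\Gamma$ is positive semi-definite and, as $n\to\infty$, $$\sqrt n\begin{pmatrix}\widehat\theta_n-\theta^*\\ \widehat\rho_n-\rho^*\end{pmatrix}\longrightarrow\mathcal N(0,\Gamma)\quad\text{in law.}$$ In particular, $\sqrt n\,(\widehat\rho_n-\rho^*)\to\mathcal N(0,\sigma_\rho^2)$ in law. (A normal law may be degenerate.) -/

import Mathlib

open Real Filter Topology MeasureTheory ProbabilityTheory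

noncomputable section

namespace DurbinWatson

/-- The least squares estimator of `θ` computed from the observations `x 0, …, x n`. -/
def thetaHat (x : ℕ → ℝ) (n : ℕ) : ℝ :=
  (∑ k ∈ Finset.Icc 1 n, x k * x (k - 1)) / (∑ k ∈ Finset.Icc 1 n, x (k - 1) ^ 2)

/-- The least squares residuals at step `n`: `x k - thetaHat x n * x (k - 1)` for `k ≥ 1`,
with the initial value `x 0`. -/
def residual (x : ℕ → ℝ) (n k : ℕ) : ℝ :=
  if k = 0 then x 0 else x k - thetaHat x n * x (k - 1)

/-- The least squares estimator of the serial correlation `ρ`, computed from the residuals. -/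
def rhoHat (x : ℕ → ℝ) (n : ℕ) : ℝ :=
  (∑ k ∈ Finset.Icc 1 n, residual x n k * residual x n (k - 1)) /
    (∑ k ∈ Finset.Icc 1 n, residual x n (k - 1) ^ 2)

/-- The limiting value `θ*`. -/
def thetaStar (θ ρ : ℝ) : ℝ := (θ + ρ) / (1 + θ * ρ)

/-- The limiting value `ρ*`. -/
def rhoStar (θ ρ : ℝ) : ℝ := θ * ρ * thetaStar θ ρ

/-- The asymptotic variance `σ_θ²`. -/
def varTheta (θ ρ : ℝ) : ℝ :=
  (1 - θ ^ 2) * (1 - θ * ρ) * (1 - ρ ^ 2) / (1 + θ * ρ) ^ 3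

/-- The asymptotic variance `σ_ρ²`. -/
def varRho (θ ρ : ℝ) : ℝ :=
  (1 - θ * ρ) / (1 + θ * ρ) ^ 3 *
    ((θ + ρ) ^ 2 * (1 + θ * ρ) ^ 2 + (θ * ρ) ^ 2 * (1 - θ ^ 2) * (1 - ρ ^ 2))

/-- The asymptotic covariance matrix `Γ`. -/
def Gam (θ ρ : ℝ) : Matrix (Fin 2) (Fin 2) ℝ :=
  !![varTheta θ ρ, θ * ρ * varTheta θ ρ; θ * ρ * varTheta θ ρ, varRho θ ρ]

end DurbinWatson

end

/-!
Write `a = θ + ρ`, `b = θ * ρ`. From time `2` on, `X` is an autoregression of order two,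
`X (k + 2) = a * X (k + 1) - b * X k + V (k + 2)`. Summing this relation against `X (k + 1)` and
squaring it express the sums which define `thetaHat` and `rhoHat` through `S = ∑ X k ^ 2`, the two
martingales `M = ∑ X k * V (k + 1)`, `N = ∑ X (k - 1) * V (k + 1)`, the sum `∑ V k ^ 2` and
boundary terms (`sum_mul_succ_identity`, `sum_sq_identity`, `sum_residual_mul_identity`,
`sum_residual_sq_identity`). Since `M` and `N` are of order `√n`, the strong law for `V ^ 2` gives
`S / n → statVar` in probability (`tendsto_second_moment`). The algebra of limits then shows that,
up to terms tending to `0` in probability, the rescaled estimation errors are fixed linear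
combinations of `M / √n` and `N / √n` (`tendsto_estimators_sub`).

Limits in probability are written as limits along one filter on `ℕ × Ω`, `probFilter`, whose
members are the sequences of events with probability tending to one. Thus sums, products,
inverses and eventual inequalities are handled by the `Tendsto` calculus.

The central limit theorem for `∑ y k * U k`, with `y k` a function of the past and `U k`
independent of it, is `tendsto_integral_exp_predictable`. The variables
`exp (i ∑ y U + v ∑ y ^ 2 / 2)` have expectation close to one, because in each factor `exp (i y U)`
may be replaced by `exp (- v y ^ 2 / 2)` up to third and fourth moments. Truncating `y` once
`∑ y ^ 2` exceeds a level keeps them bounded, and the convergence in probability of `∑ y ^ 2`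
removes both the truncation and the compensator.

As the initial values may depend on the innovations, this theorem is applied to the process
`arZero` started from `0`. It differs from `X` by a geometrically small term
(`abs_sub_arZero_le`), which is not felt at the scale `√n`. Applied to all linear combinations of
`M` and `N` it gives the limit of the characteristic functions of the linear parts
(`tendstoInDistribution_linearPart`). The limiting variance is the quadratic form of `Gam`
(`limit_variance_eq`), and Lévy's continuity theorem concludes.
-/

noncomputable section

namespace DurbinWatson

/-! ### Limits in probability -/


/-- The filter of "events whose probability tends to one": a set of pairs `(n, ω)` belongs to it
when the (outer) probability of the complement of its `n`-th section tends to `0`. A limit along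
`probFilter P` is a limit in probability, so that the calculus of `Tendsto` applies to such
limits. -/
def probFilter {Ω : Type*} [MeasurableSpace Ω] (P : Measure Ω) : Filter (ℕ × Ω) where
  sets := {A | Tendsto (fun n => P {ω | (n, ω) ∉ A}) atTop (𝓝 0)}
  univ_sets := by simp
  sets_of_superset := by
    intro A B hA hAB
    refine tendsto_of_tendsto_of_tendsto_of_le_of_le tendsto_const_nhds hA
      (fun _ => zero_le) (fun n => ?_)
    exact measure_mono fun ω hω hA' => hω (hAB hA')
  inter_sets := by
    intro A B hA hB
    have h := hA.add hB
    simp only [add_zero] at h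
    refine tendsto_of_tendsto_of_tendsto_of_le_of_le tendsto_const_nhds h
      (fun _ => zero_le) (fun n => ?_)
    refine le_trans (measure_mono ?_) (measure_union_le _ _)
    intro ω hω
    simp only [Set.mem_ofPred_eq, Set.mem_inter_iff, not_and_or] at hω
    exact hω

section Filter

variable {Ω : Type*} [MeasurableSpace Ω] {P : Measure Ω}

lemma eventually_probFilter {p : ℕ × Ω → Prop} :
    (∀ᶠ q in probFilter P, p q) ↔ Tendsto (fun n => P {ω | ¬ p (n, ω)}) atTop (𝓝 0) :=
  Iff.rfl

lemma tendsto_probFilter_iff {E : Type*} [PseudoMetricSpace E] {f : ℕ → Ω → E} {c : E} :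
    Tendsto (fun q : ℕ × Ω => f q.1 q.2) (probFilter P) (𝓝 c) ↔
      TendstoInMeasure P f atTop (fun _ => c) := by
  rw [tendstoInMeasure_iff_dist, Metric.tendsto_nhds]
  refine forall₂_congr fun δ _ => ?_
  rw [eventually_probFilter]
  simp only [not_lt]

lemma tendsto_probFilter_of_ae [IsFiniteMeasure P] {f : ℕ → Ω → ℝ} {c : ℝ}
    (hf : ∀ n, AEMeasurable (f n) P) (h : ∀ᵐ ω ∂P, Tendsto (fun n => f n ω) atTop (𝓝 c)) :
    Tendsto (fun q : ℕ × Ω => f q.1 q.2) (probFilter P) (𝓝 c) :=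
  tendsto_probFilter_iff.2 <|
    tendstoInMeasure_of_tendsto_ae (fun n => (hf n).aestronglyMeasurable) h

/-- By this lemma limits of deterministic sequences are limits along `probFilter`. -/
lemma tendsto_fst_probFilter : Tendsto (fun q : ℕ × Ω => q.1) (probFilter P) atTop := by
  rw [tendsto_atTop]
  intro N
  rw [eventually_probFilter]
  refine tendsto_const_nhds.congr' ?_
  filter_upwards [eventually_ge_atTop N] with n hn
  simp [hn]

lemma eventually_probFilter_of_ae {p : Ω → Prop} (h : ∀ᵐ ω ∂P, p ω) :
    ∀ᶠ q : ℕ × Ω in probFilter P, p q.2 := by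
  rw [eventually_probFilter]
  exact tendsto_const_nhds.congr fun _ => h.symm

/-- Boundedness in probability (tightness) of a sequence of random variables: the bound `K` is
uniform in `n`. -/
def BddInProb (P : Measure Ω) (f : ℕ → Ω → ℝ) : Prop :=
  ∀ η : ENNReal, 0 < η → ∃ K : ℝ, ∀ n, P {ω | K ≤ |f n ω|} ≤ η

lemma BddInProb.mul_tendsto_zero {f g : ℕ → Ω → ℝ} (hf : BddInProb P f)
    (hg : Tendsto (fun q : ℕ × Ω => g q.1 q.2) (probFilter P) (𝓝 0)) :
    Tendsto (fun q : ℕ × Ω => f q.1 q.2 * g q.1 q.2) (probFilter P) (𝓝 0) := by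
  rw [Metric.tendsto_nhds]
  intro δ hδ
  rw [eventually_probFilter, ENNReal.tendsto_nhds_zero]
  intro η hη
  obtain ⟨K, hK⟩ := hf (η / 2) (ENNReal.half_pos hη.ne')
  have hg' := (Metric.tendsto_nhds.1 hg) (δ / (|K| + 1)) (by positivity)
  rw [eventually_probFilter, ENNReal.tendsto_nhds_zero] at hg'
  filter_upwards [hg' (η / 2) (ENNReal.half_pos hη.ne')] with n hn
  calc P {ω | ¬ dist (f n ω * g n ω) 0 < δ}
      ≤ P ({ω | K ≤ |f n ω|} ∪ {ω | ¬ dist (g n ω) 0 < δ / (|K| + 1)}) := by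
        refine measure_mono fun ω hω => ?_
        by_contra hcon
        simp only [Set.mem_union, Set.mem_ofPred_eq, not_or, not_not, not_le] at hcon
        apply hω
        simp only [dist_zero_right, Real.norm_eq_abs] at hcon ⊢
        rw [abs_mul]
        have h1 : |f n ω| < |K| + 1 := by linarith [le_abs_self K]
        calc |f n ω| * |g n ω| ≤ (|K| + 1) * |g n ω| := by gcongr
          _ < (|K| + 1) * (δ / (|K| + 1)) := by gcongr; exact hcon.2
          _ = δ := by field_simp
    _ ≤ η / 2 + η / 2 := (measure_union_le _ _).trans (add_le_add (hK n) hn)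
    _ = η := ENNReal.add_halves η

/-- A bounded second moment gives boundedness in probability (Markov's inequality). -/
lemma bddInProb_of_eLpNorm_le {f : ℕ → Ω → ℝ} (hf : ∀ n, AEStronglyMeasurable (f n) P)
    {C : ENNReal} (hC : C ≠ ⊤) (h : ∀ n, eLpNorm (f n) 2 P ≤ C) : BddInProb P f := by
  intro η hη
  rcases eq_or_ne η ⊤ with rfl | hη'
  · exact ⟨0, fun n => le_top⟩
  obtain ⟨K, hK⟩ : ∃ K : NNReal, C ^ 2 / η < K := by
    obtain ⟨r, h1, -⟩ := ENNReal.lt_iff_exists_nnreal_btwn.1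
      (show C ^ 2 / η < ⊤ from ENNReal.div_lt_top (by simp [hC]) hη.ne')
    exact ⟨r, h1⟩
  refine ⟨K + 1, fun n => ?_⟩
  have hM := mul_meas_ge_le_pow_eLpNorm' P (p := 2) (by simp) (by simp) (hf n)
    (ENNReal.ofReal ((K : ℝ) + 1))
  have e1 : (1 : ENNReal) ≤ ENNReal.ofReal ((K : ℝ) + 1) := by
    rw [← ENNReal.ofReal_one]; exact ENNReal.ofReal_le_ofReal (by simp)
  have e2 : (K : ENNReal) ≤ ENNReal.ofReal ((K : ℝ) + 1) ^ (2 : ENNReal).toReal := by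
    have : (K : ENNReal) ≤ ENNReal.ofReal ((K : ℝ) + 1) := by
      rw [← ENNReal.ofReal_coe_nnreal]; exact ENNReal.ofReal_le_ofReal (by simp)
    refine this.trans ?_
    simp only [ENNReal.toReal_ofNat, ENNReal.rpow_ofNat]
    exact le_self_pow e1 (by norm_num)
  have e3 : {ω | (K : ℝ) + 1 ≤ |f n ω|} ⊆
      {ω | ENNReal.ofReal ((K : ℝ) + 1) ≤ ‖f n ω‖ₑ} := by
    intro ω hω
    simp only [Set.mem_ofPred_eq] at hω ⊢
    rw [Real.enorm_eq_ofReal_abs]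
    exact ENNReal.ofReal_le_ofReal hω
  have e4 : (K : ENNReal) * P {ω | (K : ℝ) + 1 ≤ |f n ω|} ≤ C ^ 2 := by
    refine (mul_le_mul' e2 (measure_mono e3)).trans (hM.trans ?_)
    simp only [ENNReal.toReal_ofNat, ENNReal.rpow_ofNat]
    exact pow_le_pow_left' (h n) 2
  have hK0 : (K : ENNReal) ≠ 0 := (lt_of_le_of_lt zero_le hK).ne'
  have e5 : C ^ 2 ≤ K * η := by
    rw [← ENNReal.div_le_iff_le_mul (Or.inl hη.ne') (Or.inl hη')]
    exact hK.le
  exact (ENNReal.mul_le_mul_iff_right hK0 (by simp)).1 (e4.trans e5)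

/-- Bounded convergence in probability. -/
lemma tendsto_integral_of_probFilter [IsProbabilityMeasure P] {f : ℕ → Ω → ℂ} {C : ℝ}
    (hf : ∀ n, AEStronglyMeasurable (f n) P) (hC : ∀ n ω, ‖f n ω‖ ≤ C)
    (h : Tendsto (fun q : ℕ × Ω => f q.1 q.2) (probFilter P) (𝓝 0)) :
    Tendsto (fun n => ∫ ω, f n ω ∂P) atTop (𝓝 0) := by
  have hm : TendstoInMeasure P f atTop (fun _ => 0) := tendsto_probFilter_iff.1 h
  have hL := tendsto_Lp_finite_of_tendstoInMeasure (p := 1) le_rfl (by simp) hf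
    (MemLp.zero : MemLp (0 : Ω → ℂ) 1 P) ?_ hm
  · have := tendsto_integral_of_L1 (f := fun _ : Ω => (0 : ℂ)) (μ := P) (F := f)
      (l := atTop) (by fun_prop) (Eventually.of_forall fun n => ?_) ?_
    · simpa using this
    · exact Integrable.of_bound (hf n) C (Eventually.of_forall (hC n))
    · simpa [eLpNorm_one_eq_lintegral_enorm] using hL
  · refine unifIntegrable_of le_rfl (by simp) hf fun ε hε => ⟨(C + 1).toNNReal, fun n => ?_⟩
    have : {x | (C + 1).toNNReal ≤ ‖f n x‖₊} = ∅ := by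
      ext x
      simp only [Set.mem_ofPred_eq, Set.mem_empty_iff_false, iff_false, not_le]
      rw [← NNReal.coe_lt_coe, coe_nnnorm]
      have := hC n x
      have := le_max_left (C+1) 0
      rw [Real.coe_toNNReal']
      linarith
    rw [this]
    simp

end Filter

/-! ### A central limit theorem for predictable weights -/


lemma norm_exp_I_sub_taylor_le (x : ℝ) :
    ‖Complex.exp (Complex.I * x) - (1 + Complex.I * x - x ^ 2 / 2)‖ ≤ 4 * |x| ^ 3 := by
  rcases le_total |x| 1 with h | h
  · have hx : ‖Complex.I * (x : ℂ)‖ = |x| := by simp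
    have := Complex.exp_bound (x := Complex.I * x) (by rw [hx]; exact h) (n := 3) (by norm_num)
    rw [hx] at this
    have e : ∑ m ∈ Finset.range 3, (Complex.I * (x : ℂ)) ^ m / (m.factorial : ℂ)
        = 1 + Complex.I * x - x ^ 2 / 2 := by
      simp [Finset.sum_range_succ, mul_pow, Nat.factorial]
      ring
    rw [e] at this
    refine this.trans ?_
    have : (0 : ℝ) ≤ |x| ^ 3 := by positivity
    norm_num [Nat.factorial]
    nlinarith
  · have h1 : ‖Complex.exp (Complex.I * x)‖ = 1 := Complex.norm_exp_I_mul_ofReal x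
    have h2 : ‖(1 + Complex.I * x - x ^ 2 / 2 : ℂ)‖ ≤ 1 + |x| + |x| ^ 2 / 2 := by
      refine (norm_sub_le _ _).trans (add_le_add ((norm_add_le _ _).trans ?_) ?_)
      · simp
      · simp
    refine (norm_sub_le _ _).trans ?_
    rw [h1]
    have h3 : |x| ≤ |x| ^ 3 := le_self_pow₀ h (by norm_num)
    have h4 : |x| ^ 2 ≤ |x| ^ 3 := pow_le_pow_right₀ h (by norm_num)
    nlinarith

lemma abs_exp_neg_sub_le {z : ℝ} (hz : 0 ≤ z) : |Real.exp (-z) - (1 - z)| ≤ z ^ 2 := by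
  have h1 : 1 - z ≤ Real.exp (-z) := by linarith [Real.add_one_le_exp (-z)]
  rw [abs_of_nonneg (by linarith)]
  have h2 : Real.exp (-z) ≤ (1 + z)⁻¹ := by
    rw [Real.exp_neg]
    exact inv_anti₀ (by linarith) (by linarith [Real.add_one_le_exp z])
  have h3 : (1 + z)⁻¹ ≤ 1 - z + z ^ 2 := by
    rw [inv_le_iff_one_le_mul₀ (by linarith)]
    nlinarith [pow_nonneg hz 3]
  linarith

lemma norm_exp_I_mul_add (a b : ℝ) :
    ‖Complex.exp (Complex.I * (a : ℂ) + (b : ℂ))‖ = Real.exp b := by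
  rw [Complex.norm_exp]
  simp

section CLT

variable {Ω : Type*} [mΩ : MeasurableSpace Ω] {P : Measure Ω} [IsProbabilityMeasure P]

lemma integrable_pow_of_memLp_four {f : Ω → ℝ} (hf : MemLp f 4 P) {j : ℕ} (hj : j ≤ 4) :
    Integrable (fun ω => |f ω| ^ j) P := by
  have h : MemLp f (j : ENNReal) P := hf.mono_exponent (by exact_mod_cast hj)
  exact h.integrable_norm_pow'

end CLT

/-- One step of the characteristic function computation. If `ζ` and `y` are determined by the
past `𝓖` and the centred `U` of variance `v` is independent of `𝓖`, then inside an expectation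
`exp (i y U)` may be replaced by `exp (- v y² / 2)` at the cost of third and fourth moments. -/
lemma norm_integral_mul_exp_sub_le {Ω : Type*} {𝓖 mΩ : MeasurableSpace Ω} {P : Measure Ω}
    [IsProbabilityMeasure P] (h𝓖 : 𝓖 ≤ mΩ) {ζ : Ω → ℂ}
    {y U : Ω → ℝ} {B v : ℝ} (hζ : Measurable[𝓖] ζ) (hy : Measurable[𝓖] y) (hU : Measurable U)
    (hind : Indep 𝓖 (MeasurableSpace.comap U inferInstance) P) (hB : ∀ ω, ‖ζ ω‖ ≤ B)
    (hy4 : MemLp y 4 P) (hU4 : MemLp U 4 P) (hU1 : ∫ ω, U ω ∂P = 0)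
    (hU2 : ∫ ω, U ω ^ 2 ∂P = v) :
    ‖∫ ω, ζ ω * (Complex.exp (Complex.I * (y ω * U ω : ℝ)) -
        (Real.exp (-(v * y ω ^ 2 / 2)) : ℝ)) ∂P‖ ≤
      B * (4 * (∫ ω, |U ω| ^ 3 ∂P) * (∫ ω, |y ω| ^ 3 ∂P) + v ^ 2 * ∫ ω, y ω ^ 4 ∂P) := by
  have hζ' : Measurable ζ := hζ.mono h𝓖 le_rfl
  have hy' : Measurable y := hy.mono h𝓖 le_rfl
  have hv : 0 ≤ v := hU2 ▸ integral_nonneg fun ω => sq_nonneg _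
  obtain ⟨ω₀⟩ : Nonempty Ω := nonempty_of_isProbabilityMeasure P
  have hB0 : 0 ≤ B := (norm_nonneg _).trans (hB ω₀)
  -- functions of the past are independent of functions of `U`
  have hindep : ∀ {E F : Type} [MeasurableSpace E] [MeasurableSpace F] {f : Ω → E} {g : ℝ → F},
      Measurable[𝓖] f → Measurable g → IndepFun f (fun ω => g (U ω)) P := by
    intro E F _ _ f g hf hg
    rw [IndepFun_iff_Indep]
    refine indep_of_indep_of_le_left (indep_of_indep_of_le_right hind ?_) hf.comap_le
    exact (hg.comp (comap_measurable U)).comap_le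
  have iy : ∀ j, j ≤ 4 → Integrable (fun ω => |y ω| ^ j) P := fun j =>
    integrable_pow_of_memLp_four hy4
  have iU : ∀ j, j ≤ 4 → Integrable (fun ω => |U ω| ^ j) P := fun j =>
    integrable_pow_of_memLp_four hU4
  have iU1 : Integrable (fun ω => (U ω : ℂ)) P := by
    refine (Integrable.mono' (iU 1 (by norm_num)) (by fun_prop) (ae_of_all _ fun ω => ?_))
    simp
  have iU2 : Integrable (fun ω => ((U ω : ℂ) ^ 2 - v)) P := by
    refine Integrable.sub
      (Integrable.mono' (iU 2 (by norm_num)) (by fun_prop) (ae_of_all _ fun ω => ?_))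
      (integrable_const _)
    simp
  have iζ1 : Integrable (fun ω => ζ ω * (Complex.I * y ω)) P := by
    refine Integrable.mono' ((iy 1 (by norm_num)).const_mul B) (by fun_prop)
      (ae_of_all _ fun ω => ?_)
    simp only [norm_mul, Complex.norm_I, one_mul, Complex.norm_real, Real.norm_eq_abs, pow_one]
    gcongr
    exact hB ω
  have iζ2 : Integrable (fun ω => ζ ω * (-(y ω : ℂ) ^ 2 / 2)) P := by
    refine Integrable.mono' ((iy 2 (by norm_num)).const_mul B) (by fun_prop)
      (ae_of_all _ fun ω => ?_)
    simp only [norm_mul, norm_div, norm_neg, norm_pow, Complex.norm_real, Real.norm_eq_abs,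
      Complex.norm_ofNat]
    have : (0 : ℝ) ≤ |y ω| ^ 2 := by positivity
    gcongr
    · exact hB ω
    · linarith
  have mζ1 : Measurable[𝓖] (fun ω => ζ ω * (Complex.I * y ω)) := by fun_prop
  have mζ2 : Measurable[𝓖] (fun ω => ζ ω * (-(y ω : ℂ) ^ 2 / 2)) := by fun_prop
  have ind1 := hindep mζ1 (g := fun x : ℝ => (x : ℂ)) (by fun_prop)
  have ind2 := hindep mζ2 (g := fun x : ℝ => ((x : ℂ) ^ 2 - v)) (by fun_prop)
  have z1 : ∫ ω, ζ ω * (Complex.I * y ω) * (U ω : ℂ) ∂P = 0 := by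
    rw [ind1.integral_fun_mul_eq_mul_integral iζ1.1 iU1.1, integral_complex_ofReal, hU1]
    simp
  have z2 : ∫ ω, ζ ω * (-(y ω : ℂ) ^ 2 / 2) * ((U ω : ℂ) ^ 2 - v) ∂P = 0 := by
    rw [ind2.integral_fun_mul_eq_mul_integral iζ2.1 iU2.1]
    have : ∫ ω, ((U ω : ℂ) ^ 2 - v) ∂P = ((∫ ω, (U ω ^ 2 - v) ∂P : ℝ) : ℂ) := by
      rw [← integral_complex_ofReal]; push_cast; rfl
    rw [this, integral_sub, hU2]
    · simp
    · simpa using iU 2 (by norm_num)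
    · exact integrable_const _
  have i1 : Integrable (fun ω => ζ ω * (Complex.I * y ω) * (U ω : ℂ)) P :=
    ind1.integrable_mul iζ1 iU1
  have i2 : Integrable (fun ω => ζ ω * (-(y ω : ℂ) ^ 2 / 2) * ((U ω : ℂ) ^ 2 - v)) P :=
    ind2.integrable_mul iζ2 iU2
  have ind3 := hindep (f := fun ω => |y ω| ^ 3) (by fun_prop)
    (g := fun x : ℝ => |x| ^ 3) (by fun_prop)
  have i3 : Integrable (fun ω => |y ω| ^ 3 * |U ω| ^ 3) P :=
    ind3.integrable_mul (iy 3 (by norm_num)) (iU 3 (by norm_num))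
  have i4 : Integrable (fun ω => y ω ^ 4) P := by
    simpa [Even.pow_abs (show Even 4 by decide)] using iy 4 le_rfl
  set G : Ω → ℂ := fun ω => ζ ω * (Complex.exp (Complex.I * (y ω * U ω : ℝ)) -
        (Real.exp (-(v * y ω ^ 2 / 2)) : ℝ)) with hG
  have iG : Integrable G P := by
    refine Integrable.of_bound (by fun_prop) (B * 2) (ae_of_all _ fun ω => ?_)
    simp only [hG, norm_mul]
    gcongr
    · exact hB ω
    · refine (norm_sub_le _ _).trans ?_
      rw [Complex.norm_exp_I_mul_ofReal, Complex.norm_real, Real.norm_eq_abs, Real.abs_exp]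
      have : Real.exp (-(v * y ω ^ 2 / 2)) ≤ 1 := Real.exp_le_one_iff.2 (by
        have := mul_nonneg hv (sq_nonneg (y ω)); linarith)
      linarith
  -- the terms of first and second order in `U`, whose expectations vanish by independence, are
  -- subtracted, so that only Taylor remainders are left
  have key : ∫ ω, G ω ∂P = ∫ ω, (G ω - ζ ω * (Complex.I * y ω) * (U ω : ℂ)
      - ζ ω * (-(y ω : ℂ) ^ 2 / 2) * ((U ω : ℂ) ^ 2 - v)) ∂P := by
    have e1 := integral_sub (iG.sub i1) i2
    have e2 := integral_sub iG i1
    simp only [Pi.sub_apply] at e1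
    rw [e1, e2, z1, z2, sub_zero, sub_zero]
  rw [key]
  calc ‖∫ ω, (G ω - ζ ω * (Complex.I * y ω) * (U ω : ℂ)
      - ζ ω * (-(y ω : ℂ) ^ 2 / 2) * ((U ω : ℂ) ^ 2 - v)) ∂P‖
      ≤ ∫ ω, B * (4 * (|y ω| ^ 3 * |U ω| ^ 3) + v ^ 2 * y ω ^ 4) ∂P := by
        refine norm_integral_le_of_norm_le
          (((i3.const_mul 4).add (i4.const_mul _)).const_mul B) (ae_of_all _ fun ω => ?_)
        have e : G ω - ζ ω * (Complex.I * y ω) * (U ω : ℂ)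
            - ζ ω * (-(y ω : ℂ) ^ 2 / 2) * ((U ω : ℂ) ^ 2 - v) =
            ζ ω * ((Complex.exp (Complex.I * (y ω * U ω : ℝ)) -
              (1 + Complex.I * (y ω * U ω : ℝ) - ((y ω * U ω : ℝ) : ℂ) ^ 2 / 2)) -
              ((Real.exp (-(v * y ω ^ 2 / 2)) - (1 - v * y ω ^ 2 / 2) : ℝ) : ℂ)) := by
          simp only [hG]
          push_cast
          ring
        rw [e, norm_mul]
        gcongr
        · exact hB ω
        · refine (norm_sub_le _ _).trans (add_le_add ?_ ?_)
          · refine (norm_exp_I_sub_taylor_le _).trans (le_of_eq ?_)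
            rw [abs_mul, mul_pow]
          · rw [Complex.norm_real, Real.norm_eq_abs]
            have h0 : 0 ≤ v * y ω ^ 2 / 2 := by positivity
            refine (abs_exp_neg_sub_le h0).trans ?_
            have : 0 ≤ v ^ 2 * y ω ^ 4 := by positivity
            nlinarith
    _ = _ := by
        rw [integral_const_mul, integral_add (i3.const_mul 4) (i4.const_mul _),
          integral_const_mul, integral_const_mul,
          ind3.integral_fun_mul_eq_mul_integral (iy 3 (by norm_num)).1 (iU 3 (by norm_num)).1]
        ring

section CLT

variable {Ω : Type*} [mΩ : MeasurableSpace Ω] {P : Measure Ω}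

/-- A sequence of innovations: `U k` is centred with variance `v`, has third absolute moment at
most `A`, is independent of the past `𝓖 k` and is known at time `k + 1`. -/
structure IsInnovation (P : Measure Ω) (𝓖 : Filtration ℕ mΩ) (U : ℕ → Ω → ℝ) (v A : ℝ) :
    Prop where
  measurable : ∀ k, Measurable[𝓖 (k + 1)] (U k)
  indep : ∀ k, Indep (𝓖 k) (MeasurableSpace.comap (U k) inferInstance) P
  memLp : ∀ k, MemLp (U k) 4 P
  mean : ∀ k, ∫ ω, U k ω ∂P = 0
  sq : ∀ k, ∫ ω, U k ω ^ 2 ∂P = v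
  third : ∀ k, ∫ ω, |U k ω| ^ 3 ∂P ≤ A

variable {𝓖 : Filtration ℕ mΩ} {U : ℕ → Ω → ℝ} {v A : ℝ}

lemma IsInnovation.measurable' (hU : IsInnovation P 𝓖 U v A) (k : ℕ) : Measurable (U k) :=
  (hU.measurable k).mono (𝓖.le _) le_rfl

lemma IsInnovation.nonneg (hU : IsInnovation P 𝓖 U v A) : 0 ≤ v :=
  hU.sq 0 ▸ integral_nonneg fun _ => sq_nonneg _

variable [IsProbabilityMeasure P]

/-- For a predictable `y` whose sum of squares is bounded by `C`, the expectation of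
`exp (i ∑ y U + v ∑ y² / 2)` differs from `1` only by third and fourth moments of `y`. -/
lemma norm_integral_exp_sub_one_le (hU : IsInnovation P 𝓖 U v A) {y : ℕ → Ω → ℝ}
    (hy : ∀ k, Measurable[𝓖 k] (y k)) (hy4 : ∀ k, MemLp (y k) 4 P) {C : ℝ} (n : ℕ)
    (hC : ∀ ω, ∑ k ∈ Finset.range n, y k ω ^ 2 ≤ C) :
    ‖∫ ω, Complex.exp (Complex.I * ((∑ k ∈ Finset.range n, y k ω * U k ω : ℝ) : ℂ)
        + ((v * (∑ k ∈ Finset.range n, y k ω ^ 2) / 2 : ℝ) : ℂ)) ∂P - 1‖ ≤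
      Real.exp (v * C / 2) * ∑ k ∈ Finset.range n,
        (4 * A * (∫ ω, |y k ω| ^ 3 ∂P) + v ^ 2 * ∫ ω, y k ω ^ 4 ∂P) := by
  have hv := hU.nonneg
  set Z : ℕ → Ω → ℂ := fun m ω => Complex.exp
    (Complex.I * ((∑ k ∈ Finset.range m, y k ω * U k ω : ℝ) : ℂ)
        + ((v * (∑ k ∈ Finset.range m, y k ω ^ 2) / 2 : ℝ) : ℂ)) with hZ
  have hy' : ∀ k, Measurable (y k) := fun k => (hy k).mono (𝓖.le _) le_rfl
  have hU' := hU.measurable'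
  have hCm : ∀ m ≤ n, ∀ ω, v * (∑ k ∈ Finset.range m, y k ω ^ 2) / 2 ≤ v * C / 2 := by
    intro m hm ω
    have : ∑ k ∈ Finset.range m, y k ω ^ 2 ≤ C :=
      (Finset.sum_le_sum_of_subset_of_nonneg (Finset.range_mono hm)
        (fun _ _ _ => sq_nonneg _)).trans (hC ω)
    gcongr
  have iZ : ∀ m ≤ n, Integrable (Z m) P := by
    intro m hm
    refine Integrable.of_bound ?_ (Real.exp (v * C / 2)) (ae_of_all _ fun ω => ?_)
    · exact Measurable.aestronglyMeasurable (by fun_prop)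
    · simp only [hZ]
      rw [norm_exp_I_mul_add]
      exact Real.exp_le_exp.2 (hCm m hm ω)
  -- `Z (m + 1) - Z m` has the form treated in the one-step estimate
  have main : ∀ m ≤ n, ‖∫ ω, Z m ω ∂P - 1‖ ≤
      Real.exp (v * C / 2) * ∑ k ∈ Finset.range m,
        (4 * A * (∫ ω, |y k ω| ^ 3 ∂P) + v ^ 2 * ∫ ω, y k ω ^ 4 ∂P) := by
    intro m
    induction m with
    | zero => intro _; simp [hZ]
    | succ m ih =>
      intro hm
      have ih' := ih (by omega)
      have hstep := norm_integral_mul_exp_sub_le (P := P) (𝓖.le m) (y := y m) (U := U m)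
        (v := v) (B := Real.exp (v * C / 2))
        (ζ := fun ω => Complex.exp (Complex.I * ((∑ k ∈ Finset.range m, y k ω * U k ω : ℝ) : ℂ)
          + ((v * (∑ k ∈ Finset.range (m + 1), y k ω ^ 2) / 2 : ℝ) : ℂ))) ?_ (hy m) (hU' m)
        (hU.indep m) ?_ (hy4 m) (hU.memLp m) (hU.mean m) (hU.sq m)
      · have e : ∀ ω, Z (m + 1) ω - Z m ω =
            Complex.exp (Complex.I * ((∑ k ∈ Finset.range m, y k ω * U k ω : ℝ) : ℂ)
              + ((v * (∑ k ∈ Finset.range (m + 1), y k ω ^ 2) / 2 : ℝ) : ℂ)) *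
            (Complex.exp (Complex.I * (y m ω * U m ω : ℝ)) -
              (Real.exp (-(v * y m ω ^ 2 / 2)) : ℝ)) := by
          intro ω
          simp only [hZ]
          rw [mul_sub, Complex.ofReal_exp, ← Complex.exp_add, ← Complex.exp_add]
          congr 2
          · rw [Finset.sum_range_succ (fun k => y k ω * U k ω)]; push_cast; ring
          · rw [Finset.sum_range_succ (fun k => y k ω ^ 2)]; push_cast; ring
        simp_rw [← e] at hstep
        rw [integral_sub (iZ _ hm) (iZ _ (by omega))] at hstep
        have hle : 4 * (∫ ω, |U m ω| ^ 3 ∂P) * (∫ ω, |y m ω| ^ 3 ∂P) ≤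
            4 * A * (∫ ω, |y m ω| ^ 3 ∂P) := by
          have : 0 ≤ ∫ ω, |y m ω| ^ 3 ∂P := integral_nonneg fun _ => by positivity
          have := hU.third m
          gcongr
        rw [Finset.sum_range_succ, mul_add]
        calc ‖∫ ω, Z (m + 1) ω ∂P - 1‖
            = ‖(∫ ω, Z m ω ∂P - 1) + (∫ ω, Z (m + 1) ω ∂P - ∫ ω, Z m ω ∂P)‖ := by ring_nf
          _ ≤ _ := (norm_add_le _ _).trans (add_le_add ih' (hstep.trans (by gcongr)))
      · have h1 : ∀ k < m, Measurable[𝓖 m] (U k) := fun k hk =>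
          (hU.measurable k).mono (𝓖.mono (by omega)) le_rfl
        have h2 : ∀ k ≤ m, Measurable[𝓖 m] (y k) := fun k hk =>
          (hy k).mono (𝓖.mono hk) le_rfl
        have h3 : Measurable[𝓖 m] (fun ω => ∑ k ∈ Finset.range m, y k ω * U k ω) := by
          refine Finset.measurable_fun_sum _ fun k hk => ?_
          have := Finset.mem_range.1 hk
          exact (h2 k this.le).mul (h1 k this)
        have h4 : Measurable[𝓖 m] (fun ω => ∑ k ∈ Finset.range (m + 1), y k ω ^ 2) := by
          refine Finset.measurable_fun_sum _ fun k hk => ?_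
          have := Finset.mem_range.1 hk
          exact (h2 k (by omega)).pow_const 2
        fun_prop
      · intro ω
        rw [norm_exp_I_mul_add]
        exact Real.exp_le_exp.2 (hCm _ hm ω)
  exact main n le_rfl

end CLT

/-- The terms of `w` are kept as long as the sum of squares, current term included, does not
exceed `C`, and replaced by `0` afterwards. -/
def truncSq (C : ℝ) (w : ℕ → ℝ) (k : ℕ) : ℝ :=
  if ∑ j ∈ Finset.range (k + 1), w j ^ 2 ≤ C then w k else 0

lemma sum_truncSq_le {C : ℝ} (hC : 0 ≤ C) (w : ℕ → ℝ) (n : ℕ) :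
    ∑ k ∈ Finset.range n, truncSq C w k ^ 2 ≤ C := by
  have : ∑ k ∈ Finset.range n, truncSq C w k ^ 2 ≤ C ∧
      ∑ k ∈ Finset.range n, truncSq C w k ^ 2 ≤ ∑ k ∈ Finset.range n, w k ^ 2 := by
    induction n with
    | zero => simpa using hC
    | succ n ih =>
      rw [Finset.sum_range_succ]
      by_cases h : ∑ j ∈ Finset.range (n + 1), w j ^ 2 ≤ C
      · rw [truncSq, if_pos h]
        rw [Finset.sum_range_succ] at h ⊢
        constructor <;> linarith [ih.2]
      · rw [truncSq, if_neg h, Finset.sum_range_succ]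
        constructor
        · linarith [ih.1]
        · nlinarith [ih.2, sq_nonneg (w n)]
  exact this.1

lemma truncSq_eq {C : ℝ} {w : ℕ → ℝ} {n : ℕ} (h : ∑ k ∈ Finset.range n, w k ^ 2 ≤ C) {k : ℕ}
    (hk : k < n) : truncSq C w k = w k :=
  if_pos ((Finset.sum_le_sum_of_subset_of_nonneg (Finset.range_mono hk)
    fun _ _ _ => sq_nonneg _).trans h)

lemma abs_truncSq_le (C : ℝ) (w : ℕ → ℝ) (k : ℕ) : |truncSq C w k| ≤ |w k| := by
  rw [truncSq]
  split_ifs <;> simp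

section CLT

variable {Ω : Type*} [mΩ : MeasurableSpace Ω] {P : Measure Ω} [IsProbabilityMeasure P]
  {𝓖 : Filtration ℕ mΩ} {U : ℕ → Ω → ℝ} {v A : ℝ}

/-- Central limit theorem for `n ^ (-1/2) ∑ y U` with predictable `y` bounded in `L⁴`, when the
empirical second moments of `y` converge in probability to the constant `τ`. -/
theorem tendsto_integral_exp_predictable (hU : IsInnovation P 𝓖 U v A) {y : ℕ → Ω → ℝ}
    (hy : ∀ k, Measurable[𝓖 k] (y k)) (hy4 : ∀ k, MemLp (y k) 4 P) {L : ℝ}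
    (hL : ∀ k, ∫ ω, y k ω ^ 4 ∂P ≤ L) {τ : ℝ} (hτ : 0 ≤ τ)
    (hQ : Tendsto (fun q : ℕ × Ω => (∑ k ∈ Finset.range q.1, y k q.2 ^ 2) / q.1)
      (probFilter P) (𝓝 τ)) :
    Tendsto (fun n : ℕ => ∫ ω, Complex.exp (Complex.I *
      (((∑ k ∈ Finset.range n, y k ω * U k ω) / √n : ℝ) : ℂ)) ∂P) atTop
      (𝓝 (Real.exp (-(v * τ / 2)) : ℝ)) := by
  have hv := hU.nonneg
  have hA : 0 ≤ A := (integral_nonneg fun _ => by positivity).trans (hU.third 0)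
  have hL0 : 0 ≤ L := (integral_nonneg fun _ => by positivity).trans (hL 0)
  have hC0 : 0 ≤ τ + 1 := by linarith
  have hy' : ∀ k, Measurable (y k) := fun k => (hy k).mono (𝓖.le _) le_rfl
  have hU' := hU.measurable'
  -- the rescaled weights, cut off at the level `τ + 1`, which is exceeded only with
  -- probability tending to zero
  set w : ℕ → ℕ → Ω → ℝ := fun n k ω => truncSq (τ + 1) (fun j => y j ω / √n) k with hw
  have mw : ∀ n k, Measurable[𝓖 k] (w n k) := by
    intro n k
    have h2 : ∀ j ≤ k, Measurable[𝓖 k] (y j) := fun j hj => (hy j).mono (𝓖.mono hj) le_rfl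
    have h4 : Measurable[𝓖 k] (fun ω => ∑ j ∈ Finset.range (k + 1), (y j ω / √n) ^ 2) := by
      refine Finset.measurable_fun_sum _ fun j hj => ?_
      have := Finset.mem_range.1 hj
      exact ((h2 j (by omega)).div_const _).pow_const 2
    exact Measurable.ite (measurableSet_le h4 measurable_const) ((hy k).div_const _)
      measurable_const
  have mw' : ∀ n k, Measurable (w n k) := fun n k => (mw n k).mono (𝓖.le _) le_rfl
  have hwle : ∀ n k ω, |w n k ω| ≤ |y k ω| / √n := by
    intro n k ω
    refine (abs_truncSq_le _ _ _).trans (le_of_eq ?_)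
    rw [abs_div, abs_of_nonneg (Real.sqrt_nonneg _)]
  have w4 : ∀ n k, MemLp (w n k) 4 P := by
    intro n k
    refine ((hy4 k).const_mul ((√n)⁻¹)).mono (mw' n k).aestronglyMeasurable
      (ae_of_all _ fun ω => ?_)
    rw [Real.norm_eq_abs, Real.norm_eq_abs]
    refine (hwle n k ω).trans (le_of_eq ?_)
    rw [abs_mul, abs_of_nonneg (inv_nonneg.2 (Real.sqrt_nonneg _)), div_eq_inv_mul]
  have wC : ∀ n ω, ∑ k ∈ Finset.range n, w n k ω ^ 2 ≤ τ + 1 := fun n ω =>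
    sum_truncSq_le hC0 _ _
  have iy3 : ∀ k, ∫ ω, |y k ω| ^ 3 ∂P ≤ 1 + L := by
    intro k
    have i4 : Integrable (fun ω => y k ω ^ 4) P := by
      simpa [Even.pow_abs (show Even 4 by decide)] using
        integrable_pow_of_memLp_four (hy4 k) le_rfl
    calc ∫ ω, |y k ω| ^ 3 ∂P ≤ ∫ ω, (1 + y k ω ^ 4) ∂P := by
          refine integral_mono (integrable_pow_of_memLp_four (hy4 k) (by norm_num))
            ((integrable_const _).add i4) fun ω => ?_
          have e : y k ω ^ 4 = |y k ω| ^ 4 := (Even.pow_abs (by decide) _).symm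
          simp only [e]
          rcases le_total |y k ω| 1 with h | h
          · have h1 : |y k ω| ^ 3 ≤ 1 := pow_le_one₀ (abs_nonneg _) h
            have : 0 ≤ |y k ω| ^ 4 := by positivity
            linarith
          · have : |y k ω| ^ 3 ≤ |y k ω| ^ 4 := pow_le_pow_right₀ h (by norm_num)
            linarith
      _ ≤ 1 + L := by
          rw [integral_add (integrable_const _) i4]
          simpa using hL k
  set Z : ℕ → Ω → ℂ := fun n ω => Complex.exp
    (Complex.I * ((∑ k ∈ Finset.range n, w n k ω * U k ω : ℝ) : ℂ)
        + ((v * (∑ k ∈ Finset.range n, w n k ω ^ 2) / 2 : ℝ) : ℂ)) with hZ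
  have Zb : ∀ n ω, ‖Z n ω‖ ≤ Real.exp (v * (τ + 1) / 2) := by
    intro n ω
    simp only [hZ]
    rw [norm_exp_I_mul_add]
    have := wC n ω
    gcongr
  have mZ : ∀ n, Measurable (Z n) := fun n => by fun_prop
  have iZ : ∀ n, Integrable (Z n) P := fun n =>
    Integrable.of_bound (mZ n).aestronglyMeasurable _ (ae_of_all _ (Zb n))
  -- the compensated exponentials of the truncated sums have expectation tending to `1`
  have hZ1 : Tendsto (fun n => ∫ ω, Z n ω ∂P) atTop (𝓝 1) := by
    rw [tendsto_iff_norm_sub_tendsto_zero]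
    set D := Real.exp (v * (τ + 1) / 2) * (4 * A * (1 + L) + v ^ 2 * L) with hD
    have hlim : Tendsto (fun n : ℕ => D * (√n)⁻¹) atTop (𝓝 0) := by
      have : Tendsto (fun n : ℕ => (√(n : ℝ))⁻¹) atTop (𝓝 0) :=
        tendsto_inv_atTop_zero.comp (Real.tendsto_sqrt_atTop.comp tendsto_natCast_atTop_atTop)
      simpa using this.const_mul D
    refine tendsto_of_tendsto_of_tendsto_of_le_of_le' tendsto_const_nhds hlim
      (Eventually.of_forall fun _ => norm_nonneg _) ?_
    filter_upwards [eventually_ge_atTop 1] with n hn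
    refine (norm_integral_exp_sub_one_le hU (mw n) (w4 n) n (wC n)).trans ?_
    have hn1 : (1 : ℝ) ≤ √n := Real.one_le_sqrt.2 (by exact_mod_cast hn)
    have hs : √(n : ℝ) ^ 2 = n := Real.sq_sqrt (by positivity)
    have hr : (√(n : ℝ))⁻¹ / n = (√(n : ℝ) ^ 3)⁻¹ := by
      nth_rewrite 2 [← hs]
      field_simp
    have hterm : ∀ k ∈ Finset.range n,
        (4 * A * (∫ ω, |w n k ω| ^ 3 ∂P) + v ^ 2 * ∫ ω, w n k ω ^ 4 ∂P) ≤
          (4 * A * (1 + L) + v ^ 2 * L) * ((√n)⁻¹ / n) := by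
      intro k _
      have h3 : ∫ ω, |w n k ω| ^ 3 ∂P ≤ (1 + L) * ((√n)⁻¹ / n) := by
        calc ∫ ω, |w n k ω| ^ 3 ∂P ≤ ∫ ω, |y k ω| ^ 3 * ((√n)⁻¹ / n) ∂P := by
              refine integral_mono (integrable_pow_of_memLp_four (w4 n k) (by norm_num))
                ((integrable_pow_of_memLp_four (hy4 k) (by norm_num)).mul_const _) fun ω => ?_
              refine (pow_le_pow_left₀ (abs_nonneg _) (hwle n k ω) 3).trans (le_of_eq ?_)
              rw [hr, div_pow, div_eq_mul_inv]
          _ ≤ _ := by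
              rw [integral_mul_const]
              gcongr
              exact iy3 k
      have h4 : ∫ ω, w n k ω ^ 4 ∂P ≤ L * ((√n)⁻¹ / n) := by
        calc ∫ ω, w n k ω ^ 4 ∂P ≤ ∫ ω, y k ω ^ 4 * ((√n)⁻¹ / n) ∂P := by
              have ev : ∀ (z : Ω → ℝ) ω, z ω ^ 4 = |z ω| ^ 4 := fun z ω =>
                (Even.pow_abs (by decide) _).symm
              simp only [ev (w n k), ev (y k)]
              refine integral_mono (integrable_pow_of_memLp_four (w4 n k) le_rfl)
                ((integrable_pow_of_memLp_four (hy4 k) le_rfl).mul_const _) fun ω => ?_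
              refine (pow_le_pow_left₀ (abs_nonneg _) (hwle n k ω) 4).trans ?_
              rw [hr, div_pow, div_eq_mul_inv]
              exact mul_le_mul_of_nonneg_left
                (inv_anti₀ (by positivity) (pow_le_pow_right₀ hn1 (by norm_num))) (by positivity)
          _ ≤ _ := by
              rw [integral_mul_const]
              gcongr
              exact hL k
      calc _ ≤ 4 * A * ((1 + L) * ((√n)⁻¹ / n)) + v ^ 2 * (L * ((√n)⁻¹ / n)) := by gcongr
        _ = _ := by ring
    refine (mul_le_mul_of_nonneg_left (Finset.sum_le_sum hterm) (Real.exp_pos _).le).trans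
      (le_of_eq ?_)
    have : (n : ℝ) ≠ 0 := by positivity
    rw [Finset.sum_const, Finset.card_range, nsmul_eq_mul, hD]
    field_simp
  have hτe : ‖((Real.exp (-(v * τ / 2)) : ℝ) : ℂ)‖ ≤ 1 := by
    rw [Complex.norm_real, Real.norm_eq_abs, Real.abs_exp]
    exact Real.exp_le_one_iff.2 (by have := mul_nonneg hv hτ; linarith)
  -- the truncation and the random compensator may be removed
  have hdiff : Tendsto (fun n : ℕ => ∫ ω, (Complex.exp (Complex.I *
      (((∑ k ∈ Finset.range n, y k ω * U k ω) / √n : ℝ) : ℂ)) -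
        Z n ω * (Real.exp (-(v * τ / 2)) : ℝ)) ∂P) atTop (𝓝 0) := by
    refine tendsto_integral_of_probFilter (C := 1 + Real.exp (v * (τ + 1) / 2))
      (fun n => Measurable.aestronglyMeasurable (by fun_prop)) (fun n ω => ?_) ?_
    · refine (norm_sub_le _ _).trans (add_le_add (Complex.norm_exp_I_mul_ofReal _).le ?_)
      rw [norm_mul]
      exact (mul_le_of_le_one_right (norm_nonneg _) hτe).trans (Zb n ω)
    · have hev : ∀ᶠ q in probFilter P,
          (∑ k ∈ Finset.range q.1, y k q.2 ^ 2) / (q.1 : ℝ) < τ + 1 :=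
        hQ.eventually_lt_const (by linarith)
      have hlim : Tendsto (fun q : ℕ × Ω => 1 - Real.exp (v * ((∑ k ∈ Finset.range q.1,
          y k q.2 ^ 2) / q.1 - τ) / 2)) (probFilter P) (𝓝 0) := by
        have hc : Continuous (fun x : ℝ => 1 - Real.exp (v * (x - τ) / 2)) := by fun_prop
        have := (hc.tendsto τ).comp hQ
        simpa [Function.comp_def] using this
      rw [tendsto_zero_iff_norm_tendsto_zero] at hlim ⊢
      refine hlim.congr' ?_
      filter_upwards [hev] with q hq
      obtain ⟨n, ω⟩ := q
      simp only at hq ⊢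
      have hsq : ∑ k ∈ Finset.range n, (y k ω / √n) ^ 2 =
          (∑ k ∈ Finset.range n, y k ω ^ 2) / n := by
        rw [Finset.sum_div]
        refine Finset.sum_congr rfl fun k _ => ?_
        rw [div_pow, Real.sq_sqrt (by positivity)]
      have hwe : ∀ k ∈ Finset.range n, w n k ω = y k ω / √n := fun k hk =>
        truncSq_eq (by rw [hsq]; exact hq.le) (Finset.mem_range.1 hk)
      have e1 : ∑ k ∈ Finset.range n, w n k ω ^ 2 = (∑ k ∈ Finset.range n, y k ω ^ 2) / n := by
        rw [← hsq]
        exact Finset.sum_congr rfl fun k hk => by rw [hwe k hk]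
      have e2 : ∑ k ∈ Finset.range n, w n k ω * U k ω =
          (∑ k ∈ Finset.range n, y k ω * U k ω) / √n := by
        rw [Finset.sum_div]
        exact Finset.sum_congr rfl fun k hk => by rw [hwe k hk]; ring
      have e3 : Complex.exp (Complex.I *
          (((∑ k ∈ Finset.range n, y k ω * U k ω) / √n : ℝ) : ℂ)) -
            Z n ω * (Real.exp (-(v * τ / 2)) : ℝ) =
          Complex.exp (Complex.I * (((∑ k ∈ Finset.range n, y k ω * U k ω) / √n : ℝ) : ℂ)) *
            ((1 - Real.exp (v * ((∑ k ∈ Finset.range n, y k ω ^ 2) / n - τ) / 2) : ℝ) : ℂ) := by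
        simp only [hZ]
        rw [e1, e2, Complex.exp_add, Complex.ofReal_sub, mul_sub, Complex.ofReal_one, mul_one,
          mul_assoc, ← Complex.ofReal_exp, ← Complex.ofReal_mul, ← Real.exp_add]
        congr 4
        ring_nf
      rw [e3, norm_mul, Complex.norm_exp_I_mul_ofReal, one_mul, Complex.norm_real]
  have hsum := hdiff.add (hZ1.mul_const ((Real.exp (-(v * τ / 2)) : ℝ) : ℂ))
  rw [zero_add, one_mul] at hsum
  refine hsum.congr fun n => ?_
  rw [integral_sub, integral_mul_const]
  · ring
  · refine Integrable.of_bound (Measurable.aestronglyMeasurable (by fun_prop)) 1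
      (ae_of_all _ fun ω => (Complex.norm_exp_I_mul_ofReal _).le)
  · exact (iZ n).mul_const _

end CLT

/-! ### Deterministic identities and first order expansion -/


section Algebra

variable {a b : ℝ} {x u : ℕ → ℝ}

lemma sum_mul_succ_identity (h : ∀ k, x (k + 2) = a * x (k + 1) - b * x k + u (k + 1)) {n : ℕ}
    (hn : 1 ≤ n) :
    (1 + b) * ∑ k ∈ Finset.range n, x (k + 1) * x k =
      a * ∑ k ∈ Finset.range n, x k ^ 2 + ∑ k ∈ Finset.range n, x k * u k +
        b * (x n * x (n - 1)) + (x 1 * x 0 - a * x 0 ^ 2 - x 0 * u 0) := by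
  induction n, hn using Nat.le_induction with
  | base => simp; ring
  | succ n hn ih =>
    obtain ⟨m, rfl⟩ : ∃ m, n = m + 1 := ⟨n - 1, by omega⟩
    rw [Finset.sum_range_succ, Finset.sum_range_succ _ (m + 1), Finset.sum_range_succ _ (m + 1),
      mul_add, ih]
    simp only [Nat.add_sub_cancel]
    rw [show m + 1 + 1 = m + 2 from rfl, h m]
    ring

/-- The energy identity of the autoregression of order two. -/
lemma sum_sq_identity (h : ∀ k, x (k + 2) = a * x (k + 1) - b * x k + u (k + 1)) {n : ℕ}
    (hn : 1 ≤ n) :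
    (1 - a ^ 2 - b ^ 2) * ∑ k ∈ Finset.range n, x k ^ 2 +
        2 * a * b * ∑ k ∈ Finset.range n, x (k + 1) * x k =
      ∑ k ∈ Finset.range n, u k ^ 2 + 2 * a * ∑ k ∈ Finset.range n, x k * u k -
        2 * b * ∑ k ∈ Finset.range n, x (k - 1) * u k -
        x n ^ 2 - b ^ 2 * x (n - 1) ^ 2 + 2 * a * b * (x n * x (n - 1)) +
        ((1 - a ^ 2) * x 0 ^ 2 - u 0 ^ 2 - 2 * a * (x 0 * u 0) + 2 * b * (x 0 * u 0)
          + x 1 ^ 2) := by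
  induction n, hn using Nat.le_induction with
  | base => simp; ring
  | succ n hn ih =>
    obtain ⟨m, rfl⟩ : ∃ m, n = m + 1 := ⟨n - 1, by omega⟩
    rw [Finset.sum_range_succ, Finset.sum_range_succ _ (m + 1), Finset.sum_range_succ _ (m + 1),
      Finset.sum_range_succ _ (m + 1), Finset.sum_range_succ _ (m + 1)]
    simp only [Nat.add_sub_cancel] at ih ⊢
    rw [show m + 1 + 1 = m + 2 from rfl, h m]
    linear_combination ih

/-- The numerator of `rhoHat`, for residuals computed with an arbitrary parameter `t`. -/
lemma sum_residual_mul_identity (h : ∀ k, x (k + 2) = a * x (k + 1) - b * x k + u (k + 1))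
    {r : ℕ → ℝ} {t : ℝ} (hr0 : r 0 = x 0) (hr : ∀ k, r (k + 1) = x (k + 1) - t * x k) {n : ℕ}
    (hn : 1 ≤ n) :
    ∑ k ∈ Finset.range n, r (k + 1) * r k =
      (1 + t ^ 2 - t * a) * ∑ k ∈ Finset.range n, x (k + 1) * x k
        + (t * b - t) * ∑ k ∈ Finset.range n, x k ^ 2
        - t * ∑ k ∈ Finset.range n, x (k - 1) * u k
        + (t * a - t ^ 2) * (x n * x (n - 1)) - t * b * x (n - 1) ^ 2 + t * (x 0 * u 0) := by
  induction n, hn using Nat.le_induction with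
  | base => simp [hr, hr0]; ring
  | succ n hn ih =>
    obtain ⟨m, rfl⟩ : ∃ m, n = m + 1 := ⟨n - 1, by omega⟩
    rw [Finset.sum_range_succ, Finset.sum_range_succ _ (m + 1), Finset.sum_range_succ _ (m + 1),
      Finset.sum_range_succ _ (m + 1), hr, hr]
    simp only [Nat.add_sub_cancel] at ih ⊢
    rw [show m + 1 + 1 = m + 2 from rfl, h m]
    linear_combination ih

lemma sum_residual_sq_identity {r : ℕ → ℝ} {t : ℝ} (hr0 : r 0 = x 0)
    (hr : ∀ k, r (k + 1) = x (k + 1) - t * x k) {n : ℕ} (hn : 1 ≤ n) :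
    ∑ k ∈ Finset.range n, r k ^ 2 =
      (1 + t ^ 2) * ∑ k ∈ Finset.range n, x k ^ 2
        - 2 * t * (∑ k ∈ Finset.range n, x (k + 1) * x k - x n * x (n - 1))
        - t ^ 2 * x (n - 1) ^ 2 := by
  induction n, hn using Nat.le_induction with
  | base => simp [hr0]; ring
  | succ n hn ih =>
    obtain ⟨m, rfl⟩ : ∃ m, n = m + 1 := ⟨n - 1, by omega⟩
    rw [Finset.sum_range_succ, Finset.sum_range_succ _ (m + 1), Finset.sum_range_succ _ (m + 1),
      hr]
    simp only [Nat.add_sub_cancel] at ih ⊢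
    linear_combination ih

lemma sum_Icc_one_eq_sum_range (f : ℕ → ℝ) (n : ℕ) :
    ∑ k ∈ Finset.Icc 1 n, f k = ∑ k ∈ Finset.range n, f (k + 1) := by
  rw [Finset.range_eq_Ico, Finset.sum_Ico_add' f 0 n 1]
  rfl

lemma thetaHat_eq (x : ℕ → ℝ) (n : ℕ) :
    thetaHat x n = (∑ k ∈ Finset.range n, x (k + 1) * x k) / ∑ k ∈ Finset.range n, x k ^ 2 := by
  simp [thetaHat, sum_Icc_one_eq_sum_range]

lemma rhoHat_eq (x : ℕ → ℝ) (n : ℕ) :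
    rhoHat x n = (∑ k ∈ Finset.range n, residual x n (k + 1) * residual x n k) /
      ∑ k ∈ Finset.range n, residual x n k ^ 2 := by
  simp [rhoHat, sum_Icc_one_eq_sum_range]

end Algebra

section Parameters

variable {θ ρ : ℝ}

lemma one_sub_sq_pos {r : ℝ} (h : |r| < 1) : 0 < 1 - r ^ 2 := by
  have := (sq_lt_one_iff_abs_lt_one r).2 h
  linarith

lemma abs_mul_lt_one (hθ : |θ| < 1) (hρ : |ρ| < 1) : |θ * ρ| < 1 := by
  rw [abs_mul]
  exact mul_lt_one_of_nonneg_of_lt_one_left (abs_nonneg _) hθ hρ.le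

lemma one_add_mul_pos (hθ : |θ| < 1) (hρ : |ρ| < 1) : 0 < 1 + θ * ρ := by
  linarith [(abs_lt.1 (abs_mul_lt_one hθ hρ)).1]

lemma one_sub_mul_pos (hθ : |θ| < 1) (hρ : |ρ| < 1) : 0 < 1 - θ * ρ := by
  linarith [(abs_lt.1 (abs_mul_lt_one hθ hρ)).2]

lemma thetaStar_mul (hθ : |θ| < 1) (hρ : |ρ| < 1) :
    thetaStar θ ρ * (1 + θ * ρ) = θ + ρ := by
  rw [thetaStar, div_mul_cancel₀ _ (one_add_mul_pos hθ hρ).ne']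

lemma one_sub_thetaStar_sq (hθ : |θ| < 1) (hρ : |ρ| < 1) :
    1 - thetaStar θ ρ ^ 2 = (1 - θ ^ 2) * (1 - ρ ^ 2) / (1 + θ * ρ) ^ 2 := by
  have := (one_add_mul_pos hθ hρ).ne'
  rw [thetaStar]
  field_simp
  ring

/-- The variance of the stationary solution: the limit of the empirical second moment of the
process. -/
def statVar (θ ρ σ : ℝ) : ℝ :=
  σ ^ 2 * (1 + θ * ρ) / ((1 - θ * ρ) * (1 - θ ^ 2) * (1 - ρ ^ 2))

lemma statVar_pos {σ : ℝ} (hσ : 0 < σ) (hθ : |θ| < 1) (hρ : |ρ| < 1) : 0 < statVar θ ρ σ := by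
  have h1 := one_add_mul_pos hθ hρ
  have h2 := one_sub_mul_pos hθ hρ
  have h3 := one_sub_sq_pos hθ
  have h4 := one_sub_sq_pos hρ
  unfold statVar
  positivity

end Parameters

section Linearization

/-- Multiplication by `f` preserves convergence to `0` along `l`. For limits in probability this
is the form in which boundedness in probability is used. -/
def MulTendstoZero {ι : Type*} (l : Filter ι) (f : ι → ℝ) : Prop :=
  ∀ g : ι → ℝ, Tendsto g l (𝓝 0) → Tendsto (fun i => f i * g i) l (𝓝 0)

lemma MulTendstoZero.of_tendsto_sub {ι : Type*} {l : Filter ι} {f f' : ι → ℝ}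
    (h : MulTendstoZero l f) (hf : Tendsto (fun i => f' i - f i) l (𝓝 0)) :
    MulTendstoZero l f' := by
  intro g hg
  have := (h g hg).add (hf.mul hg)
  simp only [mul_zero, add_zero] at this
  exact this.congr fun i => by ring

variable {ι : Type*} {l : Filter ι} {a b ts s : ℝ} {r S T M N e e' c₀ c₁ : ι → ℝ}

/-- First order expansion of the two estimators. In the application `r = √n`, `S` and `T` are the
sums of the `X k ^ 2` and `X (k + 1) * X k`, `M` and `N` are the martingale parts, and `e`, `e'`,
`c₀`, `c₁` are negligible boundary terms. -/
theorem tendsto_estimators_sub (hb : 0 < 1 + b) (hts : ts * (1 + b) = a) (hts1 : 0 < 1 - ts ^ 2)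
    (hs : 0 < s) (hr : ∀ᶠ i in l, 0 < r i) (hr' : Tendsto (fun i => (r i)⁻¹) l (𝓝 0))
    (hST : ∀ᶠ i in l, (1 + b) * T i = a * S i + M i + b * e i + c₀ i)
    (hS : Tendsto (fun i => S i / r i ^ 2) l (𝓝 s))
    (hM : MulTendstoZero l fun i => M i / r i)
    (hN : MulTendstoZero l fun i => N i / r i)
    (he : Tendsto (fun i => e i / r i) l (𝓝 0)) (he' : Tendsto (fun i => e' i / r i) l (𝓝 0))
    (hc₀ : Tendsto (fun i => c₀ i / r i) l (𝓝 0)) (hc₁ : Tendsto (fun i => c₁ i / r i) l (𝓝 0))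
    {J D t : ι → ℝ} (ht : ∀ i, t i = T i / S i)
    (hJ : ∀ᶠ i in l, J i = (1 + t i ^ 2 - t i * a) * T i + (t i * b - t i) * S i - t i * N i
      + (t i * a - t i ^ 2) * e i - t i * b * e' i + t i * c₁ i)
    (hD : ∀ᶠ i in l, D i = (1 + t i ^ 2) * S i - 2 * t i * (T i - e i) - t i ^ 2 * e' i) :
    Tendsto (fun i => r i * (t i - ts) - M i / r i * ((1 + b) * s)⁻¹) l (𝓝 0) ∧
    Tendsto (fun i => r i * (J i / D i - b * ts) -
      (M i / r i * ((ts ^ 2 + b) / ((1 + b) * (s * (1 - ts ^ 2)))) -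
        N i / r i * (ts / (s * (1 - ts ^ 2))))) l (𝓝 0) := by
  have hb' := hb.ne'
  have hSpos : ∀ᶠ i in l, 0 < S i / r i ^ 2 := hS.eventually_const_lt hs
  have hε : Tendsto (fun i => (b * e i + c₀ i) / r i) l (𝓝 0) := by
    have := (he.const_mul b).add hc₀
    simp only [mul_zero, add_zero] at this
    exact this.congr fun i => by ring
  have hSinv : Tendsto (fun i => (S i / r i ^ 2)⁻¹) l (𝓝 s⁻¹) := hS.inv₀ hs.ne'
  -- the error of `t`, exactly
  have hdiff : ∀ᶠ i in l, S i ≠ 0 ∧ T i = t i * S i ∧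
      S i * (t i - ts) = (M i + (b * e i + c₀ i)) / (1 + b) := by
    filter_upwards [hr, hSpos, hST] with i hri hSi hi
    have hS0 : S i ≠ 0 := by
      intro h0; rw [h0, zero_div] at hSi; exact lt_irrefl _ hSi
    have hT : T i = t i * S i := by rw [ht, div_mul_cancel₀ _ hS0]
    refine ⟨hS0, hT, ?_⟩
    rw [eq_div_iff hb', mul_comm _ (t i - ts)]
    rw [hT] at hi
    linear_combination hi - S i * hts
  have hθ0 : Tendsto (fun i => r i * (t i - ts) - M i / r i * ((1 + b) * s)⁻¹) l (𝓝 0) := by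
    have h1 := hM (fun i => ((S i / r i ^ 2)⁻¹ - s⁻¹) / (1 + b)) (by
      simpa using (hSinv.sub_const s⁻¹).div_const (1 + b))
    have h2 := (hε.mul hSinv).div_const (1 + b)
    simp only [zero_mul, zero_div] at h2
    have h3 := h1.add h2
    rw [add_zero] at h3
    refine h3.congr' ?_
    filter_upwards [hr, hdiff] with i hri ⟨hS0, _, hi⟩
    have : t i - ts = (M i + (b * e i + c₀ i)) / (1 + b) / S i := by
      rw [← hi]; field_simp
    rw [this]
    field_simp
    ring
  refine ⟨hθ0, ?_⟩
  have ht_lim : Tendsto t l (𝓝 ts) := by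
    have h1 := hθ0.mul hr'
    have h2 := (hM _ hr').mul_const ((1 + b) * s)⁻¹
    have h3 := (h1.add h2).add_const ts
    simp only [zero_mul, zero_add] at h3
    refine h3.congr' ?_
    filter_upwards [hr] with i hri
    field_simp
    ring
  have he2 : Tendsto (fun i => e i / r i ^ 2) l (𝓝 0) := by
    have := he.mul hr'
    rw [zero_mul] at this
    exact this.congr fun i => by ring
  have he2' : Tendsto (fun i => e' i / r i ^ 2) l (𝓝 0) := by
    have := he'.mul hr'
    rw [zero_mul] at this
    exact this.congr fun i => by ring
  have hs1 : s * (1 - ts ^ 2) ≠ 0 := (mul_pos hs hts1).ne'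
  have hDlim : Tendsto (fun i => D i / r i ^ 2) l (𝓝 (s * (1 - ts ^ 2))) := by
    have h := (((ht_lim.pow 2).const_sub 1).mul hS).add
      (((ht_lim.const_mul 2).mul he2).sub ((ht_lim.pow 2).mul he2'))
    have e0 : (1 - ts ^ 2) * s + (2 * ts * 0 - ts ^ 2 * 0) = s * (1 - ts ^ 2) := by ring
    rw [e0] at h
    refine h.congr' ?_
    filter_upwards [hD, hdiff] with i hDi ⟨_, hT, _⟩
    rw [hDi, hT]
    ring
  have hDinv := hDlim.inv₀ hs1
  have hD0 : ∀ᶠ i in l, 0 < D i / r i ^ 2 := hDlim.eventually_const_lt (mul_pos hs hts1)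
  have hA : Tendsto (fun i => (t i ^ 2 + b) / (1 + b) * (D i / r i ^ 2)⁻¹ -
      (ts ^ 2 + b) / ((1 + b) * (s * (1 - ts ^ 2)))) l (𝓝 0) := by
    have := ((((ht_lim.pow 2).add_const b).div_const (1 + b)).mul hDinv).sub_const
      ((ts ^ 2 + b) / ((1 + b) * (s * (1 - ts ^ 2))))
    convert this using 2
    field_simp
    ring
  have hB : Tendsto (fun i => t i * (D i / r i ^ 2)⁻¹ - ts / (s * (1 - ts ^ 2))) l (𝓝 0) := by
    have := (ht_lim.mul hDinv).sub_const (ts / (s * (1 - ts ^ 2)))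
    convert this using 2
    field_simp
    ring
  have hE : Tendsto (fun i => ((b * e i + c₀ i) / r i * ((t i ^ 2 + b) / (1 + b)) +
      ((t i * a - t i ^ 2 - 2 * b * ts * t i) * (e i / r i) +
        (b * ts * t i ^ 2 - t i * b) * (e' i / r i) + t i * (c₁ i / r i))) *
      (D i / r i ^ 2)⁻¹) l (𝓝 0) := by
    have h1 := hε.mul (((ht_lim.pow 2).add_const b).div_const (1 + b))
    have h2 := (((ht_lim.mul_const a).sub (ht_lim.pow 2)).sub
      (ht_lim.const_mul (2 * b * ts))).mul he
    have h3 := (((ht_lim.pow 2).const_mul (b * ts)).sub (ht_lim.mul_const b)).mul he'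
    have h4 := ht_lim.mul hc₁
    have h5 := (h1.add ((h2.add h3).add h4)).mul hDinv
    simpa using h5
  have hfin := ((hM _ hA).sub (hN _ hB)).add hE
  simp only [sub_zero, add_zero] at hfin
  refine hfin.congr' ?_
  filter_upwards [hr, hdiff, hJ, hD0, hD] with i hri ⟨hS0, hT, hi⟩ hJi hDi hDD
  have hDi0 : D i ≠ 0 := by
    intro h0; rw [h0, zero_div] at hDi; exact lt_irrefl _ hDi
  -- the main part of the left side factors as `S (t - ts) (t² + b)`, by the relation
  -- between `ts` and `a`
  have hnum : J i - b * ts * D i = (M i + (b * e i + c₀ i)) / (1 + b) * (t i ^ 2 + b)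
      - t i * N i + (t i * a - t i ^ 2 - 2 * b * ts * t i) * e i +
        (b * ts * t i ^ 2 - t i * b) * e' i + t i * c₁ i := by
    rw [← hi, hJi, hDD, hT, ← hts]
    ring
  have hJD : J i / D i - b * ts = ((M i + (b * e i + c₀ i)) / (1 + b) * (t i ^ 2 + b)
      - t i * N i + (t i * a - t i ^ 2 - 2 * b * ts * t i) * e i +
        (b * ts * t i ^ 2 - t i * b) * e' i + t i * c₁ i) / D i := by
    rw [← hnum]
    field_simp
  rw [hJD]
  generalize (ts ^ 2 + b) / ((1 + b) * (s * (1 - ts ^ 2))) = w₁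
  generalize ts / (s * (1 - ts ^ 2)) = w₂
  have hri' := hri.ne'
  field_simp
  ring

/-- Convergence of the empirical second moment, from the energy identity. -/
lemma tendsto_second_moment {θ ρ σ : ℝ} (hθ : |θ| < 1) (hρ : |ρ| < 1) (ha : a = θ + ρ)
    (hb : b = θ * ρ) {W c₂ n : ι → ℝ}
    (hST : ∀ᶠ i in l, (1 + b) * T i = a * S i + M i + b * e i + c₀ i)
    (hE : ∀ᶠ i in l, (1 - a ^ 2 - b ^ 2) * S i + 2 * a * b * T i = W i + 2 * a * M i
      - 2 * b * N i - e' i - b ^ 2 * c₁ i + 2 * a * b * e i + c₂ i)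
    (hW : Tendsto (fun i => W i / n i) l (𝓝 (σ ^ 2)))
    (hM : Tendsto (fun i => M i / n i) l (𝓝 0)) (hN : Tendsto (fun i => N i / n i) l (𝓝 0))
    (he : Tendsto (fun i => e i / n i) l (𝓝 0)) (he' : Tendsto (fun i => e' i / n i) l (𝓝 0))
    (hc₀ : Tendsto (fun i => c₀ i / n i) l (𝓝 0)) (hc₁ : Tendsto (fun i => c₁ i / n i) l (𝓝 0))
    (hc₂ : Tendsto (fun i => c₂ i / n i) l (𝓝 0)) :
    Tendsto (fun i => S i / n i) l (𝓝 (statVar θ ρ σ)) ∧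
    Tendsto (fun i => T i / n i) l (𝓝 (thetaStar θ ρ * statVar θ ρ σ)) := by
  subst ha hb
  have h1 := one_add_mul_pos hθ hρ
  have h2 := one_sub_mul_pos hθ hρ
  have h3 := one_sub_sq_pos hθ
  have h4 := one_sub_sq_pos hρ
  set b := θ * ρ with hb
  set a := θ + ρ with ha
  have hS : Tendsto (fun i => S i / n i) l (𝓝 (statVar θ ρ σ)) := by
    have h := ((((((((hW.add (hM.const_mul (2 * a))).sub (hN.const_mul (2 * b))).sub he').sub
      (hc₁.const_mul (b ^ 2))).add (he.const_mul (2 * a * b))).add hc₂).mul_const (1 + b)).sub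
      (((hM.add (he.const_mul b)).add hc₀).const_mul (2 * a * b))).div_const
        ((1 - b) * (1 - θ ^ 2) * (1 - ρ ^ 2))
    have e0 : ((σ ^ 2 + 2 * a * 0 - 2 * b * 0 - 0 - b ^ 2 * 0 + 2 * a * b * 0 + 0) * (1 + b) -
        2 * a * b * (0 + b * 0 + 0)) / ((1 - b) * (1 - θ ^ 2) * (1 - ρ ^ 2)) =
        statVar θ ρ σ := by
      rw [statVar, ← hb]
      ring
    rw [e0] at h
    refine h.congr' ?_
    filter_upwards [hST, hE] with i h5 h6
    rw [div_eq_iff (by positivity)]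
    have h7 : S i * ((1 - b) * (1 - θ ^ 2) * (1 - ρ ^ 2)) =
        (W i + 2 * a * M i - 2 * b * N i - e' i - b ^ 2 * c₁ i + 2 * a * b * e i + c₂ i) *
          (1 + b) - 2 * a * b * (M i + b * e i + c₀ i) := by
      rw [← h6]
      have h8 : M i + b * e i + c₀ i = (1 + b) * T i - a * S i := by rw [h5]; ring
      rw [h8, ha, hb]
      ring
    linear_combination -(n i)⁻¹ * h7
  refine ⟨hS, ?_⟩
  have h := ((((hS.const_mul a).add hM).add (he.const_mul b)).add hc₀).div_const (1 + b)
  have e0 : (a * statVar θ ρ σ + 0 + b * 0 + 0) / (1 + b) = thetaStar θ ρ * statVar θ ρ σ := by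
    rw [thetaStar]; ring
  rw [e0] at h
  refine h.congr' ?_
  filter_upwards [hST] with i h5
  rw [div_eq_iff h1.ne']
  linear_combination -(n i)⁻¹ * h5

end Linearization

/-! ### The process started from zero and its moments -/


/-- The solution of `z (n + 1) = r * z n + w n` started from `0`. -/
def linRec (r : ℝ) (w : ℕ → ℝ) : ℕ → ℝ
  | 0 => 0
  | n + 1 => r * linRec r w n + w n

/-- The autoregressive process with autoregressive noise, started from `0`. -/
def arZero (θ ρ : ℝ) (u : ℕ → ℝ) : ℕ → ℝ :=
  linRec θ fun k => linRec ρ u (k + 1)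

lemma arZero_rec (θ ρ : ℝ) (u : ℕ → ℝ) (k : ℕ) :
    arZero θ ρ u (k + 2) =
      (θ + ρ) * arZero θ ρ u (k + 1) - θ * ρ * arZero θ ρ u k + u (k + 1) := by
  simp only [arZero, linRec]
  ring

/-- Two solutions of the same equations differ by a term which decays geometrically. -/
lemma abs_sub_arZero_le {θ ρ q : ℝ} (hθ : |θ| < q) (hρ : |ρ| < q) {x e u : ℕ → ℝ}
    (hx : ∀ k, x (k + 1) = θ * x k + e (k + 1)) (he : ∀ k, e (k + 1) = ρ * e k + u k) (k : ℕ) :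
    |x k - arZero θ ρ u k| ≤ (|x 0| + |e 0| / (1 - |θ| / q)) * q ^ k := by
  have hq : 0 < q := (abs_nonneg _).trans_lt hθ
  have h1 : 0 < 1 - |θ| / q := by
    rw [sub_pos, div_lt_one hq]; exact hθ
  have hE : ∀ k, |e k - linRec ρ u k| ≤ |e 0| * q ^ k := by
    intro k
    induction k with
    | zero => simp [linRec]
    | succ k ih =>
      rw [he, linRec, add_sub_add_right_eq_sub, ← mul_sub, abs_mul]
      calc |ρ| * |e k - linRec ρ u k| ≤ q * (|e 0| * q ^ k) := by gcongr
        _ = _ := by ring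
  set D := |x 0| + |e 0| / (1 - |θ| / q) with hD
  -- the constant `D` is chosen so that the induction step closes
  have hD' : |θ| * D + |e 0| * q ≤ D * q := by
    have : |e 0| ≤ D * (1 - |θ| / q) := by
      rw [hD, add_mul, div_mul_cancel₀ _ h1.ne']
      have := mul_nonneg (abs_nonneg (x 0)) h1.le
      linarith
    have h2 : D * (1 - |θ| / q) * q = D * q - |θ| * D := by field_simp
    nlinarith
  induction k with
  | zero =>
    simp only [arZero, linRec, sub_zero, pow_zero, mul_one, hD]
    linarith [div_nonneg (abs_nonneg (e 0)) h1.le]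
  | succ k ih =>
    have e1 : x (k + 1) - arZero θ ρ u (k + 1) =
        θ * (x k - arZero θ ρ u k) + (e (k + 1) - linRec ρ u (k + 1)) := by
      rw [hx]; simp only [arZero, linRec]; ring
    rw [e1]
    calc _ ≤ |θ| * |x k - arZero θ ρ u k| + |e (k + 1) - linRec ρ u (k + 1)| := by
          rw [← abs_mul]; exact abs_add_le _ _
      _ ≤ |θ| * (D * q ^ k) + |e 0| * q ^ (k + 1) := by gcongr; exact hE _
      _ = (|θ| * D + |e 0| * q) * q ^ k := by ring
      _ ≤ D * q * q ^ k := by gcongr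
      _ = _ := by ring

section Moments

variable {Ω : Type*} [mΩ : MeasurableSpace Ω] {P : Measure Ω}

/-- A stable linear recursion driven by noise bounded in `Lᵖ` stays bounded in `Lᵖ`. -/
lemma eLpNorm_linRec_le {r c : ℝ} (hr : |r| < 1) (hc : 0 ≤ c) {p : ENNReal} (hp : 1 ≤ p)
    {w : ℕ → Ω → ℝ} (hw : ∀ k, AEStronglyMeasurable (w k) P)
    (h : ∀ k, eLpNorm (w k) p P ≤ ENNReal.ofReal c) (k : ℕ) :
    AEStronglyMeasurable (fun ω => linRec r (fun j => w j ω) k) P ∧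
      eLpNorm (fun ω => linRec r (fun j => w j ω) k) p P ≤ ENNReal.ofReal (c / (1 - |r|)) := by
  have h1 : 0 < 1 - |r| := by linarith
  induction k with
  | zero => simp [linRec, aestronglyMeasurable_const]
  | succ k ih =>
    simp only [linRec]
    refine ⟨(ih.1.const_mul r).add (hw k), ?_⟩
    refine (eLpNorm_add_le (ih.1.const_mul r) (hw k) hp).trans ?_
    have e1 : eLpNorm (fun ω => r * linRec r (fun j => w j ω) k) p P =
        ENNReal.ofReal |r| * eLpNorm (fun ω => linRec r (fun j => w j ω) k) p P := by
      rw [← Real.enorm_eq_ofReal_abs]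
      exact eLpNorm_const_smul r _ p P
    rw [e1]
    calc _ ≤ ENNReal.ofReal |r| * ENNReal.ofReal (c / (1 - |r|)) + ENNReal.ofReal c := by
          gcongr
          · exact ih.2
          · exact h k
      _ = ENNReal.ofReal (c / (1 - |r|)) := by
          rw [← ENNReal.ofReal_mul (abs_nonneg _), ← ENNReal.ofReal_add (by positivity) hc]
          congr 1
          field_simp
          ring

lemma measurable_linRec {𝓖 : Filtration ℕ mΩ} {w : ℕ → Ω → ℝ}
    (hw : ∀ k, Measurable[𝓖 (k + 1)] (w k)) (r : ℝ) (k : ℕ) :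
    Measurable[𝓖 k] (fun ω => linRec r (fun j => w j ω) k) := by
  induction k with
  | zero => exact measurable_const
  | succ k ih =>
    have ih' : Measurable[𝓖 (k + 1)] (fun ω => linRec r (fun j => w j ω) k) :=
      ih.mono (𝓖.mono (Nat.le_succ k)) le_rfl
    exact (ih'.const_mul r).add (hw k)

lemma integral_pow_four_le {f : Ω → ℝ} (hf : MemLp f 4 P) {c : ℝ} (hc : 0 ≤ c)
    (h : eLpNorm f 4 P ≤ ENNReal.ofReal c) : ∫ ω, f ω ^ 4 ∂P ≤ c ^ 4 := by
  have h1 := hf.eLpNorm_eq_integral_rpow_norm (by simp) (by simp)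
  rw [h1] at h
  have h0 : 0 ≤ ∫ ω, f ω ^ 4 ∂P := integral_nonneg fun _ => by positivity
  have h2 := (ENNReal.ofReal_le_ofReal_iff hc).1 h
  have e : ∀ ω, ‖f ω‖ ^ (ENNReal.toReal 4) = f ω ^ 4 := by
    intro ω
    rw [ENNReal.toReal_ofNat, Real.norm_eq_abs, show (4 : ℝ) = ((4 : ℕ) : ℝ) by norm_num,
      Real.rpow_natCast, Even.pow_abs (by decide)]
  simp_rw [e] at h2
  have h3 := pow_le_pow_left₀ (by positivity) h2 4
  rwa [← Real.rpow_natCast (_ ^ _) 4, ← Real.rpow_mul h0, ENNReal.toReal_ofNat, Nat.cast_ofNat,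
    inv_mul_cancel₀ (by norm_num), Real.rpow_one] at h3

lemma integral_pow_two_le {f : Ω → ℝ} [IsProbabilityMeasure P] (hf : MemLp f 4 P) :
    ∫ ω, f ω ^ 2 ∂P ≤ 1 + ∫ ω, f ω ^ 4 ∂P := by
  have i2 := integrable_pow_of_memLp_four hf (j := 2) (by norm_num)
  have i4 := integrable_pow_of_memLp_four hf (j := 4) le_rfl
  simp only [sq_abs, Even.pow_abs (show Even 4 by decide)] at i2 i4
  calc ∫ ω, f ω ^ 2 ∂P ≤ ∫ ω, (1 + f ω ^ 4) ∂P := by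
        refine integral_mono i2 ((integrable_const _).add i4) fun ω => ?_
        simp only
        nlinarith [sq_nonneg (f ω ^ 2 - 1), sq_nonneg (f ω)]
    _ = _ := by rw [integral_add (integrable_const _) i4]; simp

lemma bddInProb_of_integral_sq_le {f : ℕ → Ω → ℝ} (hf : ∀ n, MemLp (f n) 2 P) {C : ℝ}
    (h : ∀ n, ∫ ω, f n ω ^ 2 ∂P ≤ C) : BddInProb P f := by
  refine bddInProb_of_eLpNorm_le (fun n => (hf n).1) (C := ENNReal.ofReal (√C))
    ENNReal.ofReal_ne_top fun n => ?_
  rw [(hf n).eLpNorm_eq_integral_rpow_norm (by simp) (by simp)]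
  apply ENNReal.ofReal_le_ofReal
  simp only [ENNReal.toReal_ofNat, Real.rpow_ofNat, Real.norm_eq_abs, sq_abs]
  rw [show (2 : ℝ)⁻¹ = 1 / 2 by norm_num, ← Real.sqrt_eq_rpow]
  exact Real.sqrt_le_sqrt (h n)

variable [IsProbabilityMeasure P] {𝓖 : Filtration ℕ mΩ} {U : ℕ → Ω → ℝ} {v A : ℝ}

/-- Orthogonality of martingale increments. -/
lemma integral_sum_sq (hU : IsInnovation P 𝓖 U v A) {y : ℕ → Ω → ℝ}
    (hy : ∀ k, Measurable[𝓖 k] (y k)) (hy4 : ∀ k, MemLp (y k) 4 P) (n : ℕ) :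
    MemLp (fun ω => ∑ k ∈ Finset.range n, y k ω * U k ω) 2 P ∧
    ∫ ω, (∑ k ∈ Finset.range n, y k ω * U k ω) ^ 2 ∂P =
      ∑ k ∈ Finset.range n, (∫ ω, y k ω ^ 2 ∂P) * v := by
  have hindep : ∀ (k : ℕ) {f : Ω → ℝ} {g : ℝ → ℝ}, Measurable[𝓖 k] f → Measurable g →
      IndepFun f (fun ω => g (U k ω)) P := by
    intro k f g hf hg
    rw [IndepFun_iff_Indep]
    refine indep_of_indep_of_le_left (indep_of_indep_of_le_right (hU.indep k) ?_) hf.comap_le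
    exact (hg.comp (comap_measurable (U k))).comap_le
  have i2 : ∀ {f : Ω → ℝ}, MemLp f 4 P → Integrable (fun ω => f ω ^ 2) P := fun hf => by
    simpa using integrable_pow_of_memLp_four hf (j := 2) (by norm_num)
  have hU2 : ∀ k, MemLp (U k) 2 P := fun k => (hU.memLp k).mono_exponent (by norm_num)
  have hy2 : ∀ k, MemLp (y k) 2 P := fun k => (hy4 k).mono_exponent (by norm_num)
  have iyU : ∀ k, Integrable (fun ω => y k ω ^ 2 * U k ω ^ 2) P := fun k =>
    (hindep k ((hy k).pow_const 2) (g := fun x => x ^ 2) (by fun_prop)).integrable_mul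
      (i2 (hy4 k)) (i2 (hU.memLp k))
  have myU : ∀ k, MemLp (fun ω => y k ω * U k ω) 2 P := by
    intro k
    refine (memLp_two_iff_integrable_sq (f := fun ω => y k ω * U k ω)
      ((hy4 k).1.mul (hU.memLp k).1)).2 ?_
    exact (iyU k).congr (ae_of_all _ fun ω => by simp only; ring)
  induction n with
  | zero => simp
  | succ n ih =>
    have hM := ih.1
    have mM : Measurable[𝓖 n] (fun ω => ∑ k ∈ Finset.range n, y k ω * U k ω) := by
      refine Finset.measurable_fun_sum _ fun k hk => ?_
      have hk' := Finset.mem_range.1 hk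
      exact ((hy k).mono (𝓖.mono hk'.le) le_rfl).mul
        ((hU.measurable k).mono (𝓖.mono hk') le_rfl)
    have iMy : Integrable (fun ω => (∑ k ∈ Finset.range n, y k ω * U k ω) * y n ω) P :=
      hM.integrable_mul (hy2 n)
    have indM := hindep n (mM.mul (hy n)) (g := fun x => x) measurable_id
    have iMyU := indM.integrable_mul iMy ((hU2 n).integrable (by norm_num))
    have z : ∫ ω, ((∑ k ∈ Finset.range n, y k ω * U k ω) * y n ω) * U n ω ∂P = 0 := by
      have := indM.integral_fun_mul_eq_mul_integral iMy.1 (hU.memLp n).1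
      rw [hU.mean, mul_zero] at this
      exact this
    have hsq : ∫ ω, y n ω ^ 2 * U n ω ^ 2 ∂P = (∫ ω, y n ω ^ 2 ∂P) * v := by
      rw [(hindep n ((hy n).pow_const 2) (g := fun x => x ^ 2)
        (by fun_prop)).integral_fun_mul_eq_mul_integral (i2 (hy4 n)).1 (i2 (hU.memLp n)).1,
        hU.sq]
    constructor
    · simp_rw [Finset.sum_range_succ]
      exact hM.add (myU n)
    · rw [Finset.sum_range_succ, ← ih.2, ← hsq]
      have e : ∀ ω, (∑ k ∈ Finset.range (n + 1), y k ω * U k ω) ^ 2 =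
          ((∑ k ∈ Finset.range n, y k ω * U k ω) ^ 2 +
            2 * (((∑ k ∈ Finset.range n, y k ω * U k ω) * y n ω) * U n ω)) +
          y n ω ^ 2 * U n ω ^ 2 := by
        intro ω
        rw [Finset.sum_range_succ]
        ring
      simp_rw [e]
      have iMM : Integrable (fun ω => (∑ k ∈ Finset.range n, y k ω * U k ω) ^ 2) P :=
        hM.integrable_sq
      have i2' : Integrable (fun ω =>
          2 * (((∑ k ∈ Finset.range n, y k ω * U k ω) * y n ω) * U n ω)) P := iMyU.const_mul 2
      have i3 : Integrable (fun ω => (∑ k ∈ Finset.range n, y k ω * U k ω) ^ 2 +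
          2 * (((∑ k ∈ Finset.range n, y k ω * U k ω) * y n ω) * U n ω)) P := iMM.add i2'
      rw [integral_add i3 (iyU n), integral_add iMM i2', integral_const_mul, z]
      ring

lemma bddInProb_sum_div_sqrt (hU : IsInnovation P 𝓖 U v A) {y : ℕ → Ω → ℝ}
    (hy : ∀ k, Measurable[𝓖 k] (y k)) (hy4 : ∀ k, MemLp (y k) 4 P) {L : ℝ}
    (hL : ∀ k, ∫ ω, y k ω ^ 4 ∂P ≤ L) :
    BddInProb P (fun n ω => (∑ k ∈ Finset.range n, y k ω * U k ω) / √n) := by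
  have hv := hU.nonneg
  have hL0 : 0 ≤ L := (integral_nonneg fun _ => by positivity).trans (hL 0)
  refine bddInProb_of_integral_sq_le (C := (1 + L) * v) (fun n => ?_) (fun n => ?_)
  · simp_rw [div_eq_mul_inv]
    exact (integral_sum_sq hU hy hy4 n).1.mul_const _
  · simp_rw [div_pow, Real.sq_sqrt (Nat.cast_nonneg n)]
    rw [integral_div, (integral_sum_sq hU hy hy4 n).2]
    refine div_le_of_le_mul₀ (by positivity) (by positivity) ?_
    calc ∑ k ∈ Finset.range n, (∫ ω, y k ω ^ 2 ∂P) * v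
        ≤ ∑ k ∈ Finset.range n, (1 + L) * v := by
          refine Finset.sum_le_sum fun k _ => ?_
          have := integral_pow_two_le (hy4 k)
          have := hL k
          gcongr
          linarith
      _ = _ := by rw [Finset.sum_const, Finset.card_range, nsmul_eq_mul]; ring

end Moments

section Innovations

variable {Ω : Type*} [mΩ : MeasurableSpace Ω] {P : Measure Ω}

/-- The strict past of a sequence: `strictPast hU k` is generated by the `U j`, `j < k`. -/
def strictPast {U : ℕ → Ω → ℝ} (hU : ∀ k, Measurable (U k)) : Filtration ℕ mΩ where
  seq k := ⨆ j ∈ Set.Iio k, MeasurableSpace.comap (U j) inferInstance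
  mono' _ _ h := biSup_mono fun _ hj => lt_of_lt_of_le hj h
  le' _ := iSup₂_le fun j _ => (hU j).comap_le

lemma isInnovation_of_iIndepFun {U : ℕ → Ω → ℝ} (hU : ∀ k, Measurable (U k))
    (hind : iIndepFun U P) (hid : ∀ k, IdentDistrib (U k) (U 0) P P) (h4 : MemLp (U 0) 4 P)
    (h0 : ∫ ω, U 0 ω ∂P = 0) :
    IsInnovation P (strictPast hU) U (∫ ω, U 0 ω ^ 2 ∂P) (∫ ω, |U 0 ω| ^ 3 ∂P) where
  measurable k := by
    refine Measurable.of_comap_le ?_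
    exact le_biSup (fun j => MeasurableSpace.comap (U j) inferInstance)
      (show k ∈ Set.Iio (k + 1) from Nat.lt_succ_self k)
  indep k := by
    have h := indep_iSup_of_disjoint (fun j => (hU j).comap_le) hind
      (S := Set.Iio k) (T := {k}) (by simp)
    simpa [strictPast] using h
  memLp k := (hid k).memLp_iff.2 h4
  mean k := by rw [(hid k).integral_eq, h0]
  sq k := ((hid k).comp (u := fun x => x ^ 2) (by fun_prop)).integral_eq
  third k := ((hid k).comp (u := fun x => |x| ^ 3) (by fun_prop)).integral_eq.le

/-- Linear combinations of two consecutive values of the process started from `0`. At `k = 0` the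
truncated subtraction is harmless, since `arZero` vanishes at `0`. -/
def arComb (θ ρ c₁ c₂ : ℝ) (U : ℕ → Ω → ℝ) (k : ℕ) (ω : Ω) : ℝ :=
  c₁ * arZero θ ρ (fun j => U j ω) k + c₂ * arZero θ ρ (fun j => U j ω) (k - 1)

variable {𝓖 : Filtration ℕ mΩ} {U : ℕ → Ω → ℝ} {v A : ℝ} {θ ρ : ℝ}

lemma measurable_arZero (hU : ∀ k, Measurable[𝓖 (k + 1)] (U k)) (k : ℕ) :
    Measurable[𝓖 k] (fun ω => arZero θ ρ (fun j => U j ω) k) :=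
  measurable_linRec (w := fun j ω => linRec ρ (fun i => U i ω) (j + 1))
    (fun k => measurable_linRec hU ρ (k + 1)) θ k

lemma measurable_arComb (hU : ∀ k, Measurable[𝓖 (k + 1)] (U k)) (c₁ c₂ : ℝ) (k : ℕ) :
    Measurable[𝓖 k] (arComb θ ρ c₁ c₂ U k) :=
  ((measurable_arZero hU k).const_mul c₁).add
    (((measurable_arZero hU (k - 1)).mono (𝓖.mono (Nat.sub_le k 1)) le_rfl).const_mul c₂)

lemma exists_memLp_arComb (hθ : |θ| < 1) (hρ : |ρ| < 1) (hU : ∀ k, Measurable (U k))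
    (hid : ∀ k, IdentDistrib (U k) (U 0) P P) (h4 : MemLp (U 0) 4 P) (c₁ c₂ : ℝ) :
    ∃ L, ∀ k, MemLp (arComb θ ρ c₁ c₂ U k) 4 P ∧ ∫ ω, arComb θ ρ c₁ c₂ U k ω ^ 4 ∂P ≤ L := by
  set c := (eLpNorm (U 0) 4 P).toReal with hc
  have hc0 : 0 ≤ c := ENNReal.toReal_nonneg
  have hUc : ∀ k, eLpNorm (U k) 4 P ≤ ENNReal.ofReal c := fun k => by
    rw [(hid k).eLpNorm_eq, hc, ENNReal.ofReal_toReal h4.eLpNorm_ne_top]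
  have hθ1 : 0 < 1 - |θ| := by linarith
  have hρ1 : 0 < 1 - |ρ| := by linarith
  have h1 := eLpNorm_linRec_le hρ hc0 (p := 4) (by norm_num)
    (fun k => (hU k).aestronglyMeasurable) hUc
  set d := c / (1 - |ρ|) / (1 - |θ|) with hd
  have hd0 : 0 ≤ d := by positivity
  have h2 : ∀ k, AEStronglyMeasurable (fun ω => arZero θ ρ (fun j => U j ω) k) P ∧
      eLpNorm (fun ω => arZero θ ρ (fun j => U j ω) k) 4 P ≤ ENNReal.ofReal d := fun k =>
    eLpNorm_linRec_le hθ (c := c / (1 - |ρ|)) (by positivity) (p := 4) (by norm_num)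
      (w := fun j ω => linRec ρ (fun i => U i ω) (j + 1)) (fun k => (h1 (k + 1)).1)
      (fun k => (h1 (k + 1)).2) k
  refine ⟨(|c₁| * d + |c₂| * d) ^ 4, fun k => ?_⟩
  have hm : ∀ (a : ℝ) k, AEStronglyMeasurable (fun ω => a * arZero θ ρ (fun j => U j ω) k) P :=
    fun a k => (h2 k).1.const_mul a
  have hn : ∀ (a : ℝ) k, eLpNorm (fun ω => a * arZero θ ρ (fun j => U j ω) k) 4 P ≤
      ENNReal.ofReal (|a| * d) := by
    intro a k
    rw [ENNReal.ofReal_mul (abs_nonneg _), ← Real.enorm_eq_ofReal_abs]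
    refine (eLpNorm_const_smul a _ 4 P).le.trans ?_
    gcongr
    exact (h2 k).2
  have hY : eLpNorm (arComb θ ρ c₁ c₂ U k) 4 P ≤ ENNReal.ofReal (|c₁| * d + |c₂| * d) := by
    refine (eLpNorm_add_le (hm c₁ k) (hm c₂ (k - 1)) (by norm_num)).trans ?_
    rw [ENNReal.ofReal_add (by positivity) (by positivity)]
    exact add_le_add (hn c₁ k) (hn c₂ (k - 1))
  have hL : MemLp (arComb θ ρ c₁ c₂ U k) 4 P :=
    ⟨(hm c₁ k).add (hm c₂ (k - 1)), hY.trans_lt ENNReal.ofReal_lt_top⟩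
  exact ⟨hL, integral_pow_four_le hL (by positivity) hY⟩

end Innovations

/-! ### Limit theorems for the process -/


section Autoregression

variable {Ω : Type*} [mΩ : MeasurableSpace Ω] {P : Measure Ω}

lemma BddInProb.mulTendstoZero {f : ℕ → Ω → ℝ} (hf : BddInProb P f) :
    MulTendstoZero (probFilter P) fun q => f q.1 q.2 := fun g hg =>
  hf.mul_tendsto_zero (g := fun n ω => g (n, ω)) hg

lemma tendsto_inv_sqrt_probFilter :
    Tendsto (fun q : ℕ × Ω => (√(q.1 : ℝ))⁻¹) (probFilter P) (𝓝 0) := by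
  have : Tendsto (fun n : ℕ => (√(n : ℝ))⁻¹) atTop (𝓝 0) :=
    tendsto_inv_atTop_zero.comp (Real.tendsto_sqrt_atTop.comp tendsto_natCast_atTop_atTop)
  exact this.comp tendsto_fst_probFilter

lemma tendsto_const_div_sqrt [IsFiniteMeasure P] {Y : Ω → ℝ} (hY : AEMeasurable Y P) :
    Tendsto (fun q : ℕ × Ω => Y q.2 / √(q.1 : ℝ)) (probFilter P) (𝓝 0) := by
  refine tendsto_probFilter_of_ae (f := fun n ω => Y ω / √(n : ℝ))
    (fun n => hY.div_const _) (ae_of_all _ fun ω => ?_)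
  have : Tendsto (fun n : ℕ => (√(n : ℝ))⁻¹) atTop (𝓝 0) :=
    tendsto_inv_atTop_zero.comp (Real.tendsto_sqrt_atTop.comp tendsto_natCast_atTop_atTop)
  simpa [div_eq_mul_inv] using this.const_mul (Y ω)

lemma tendsto_mul_div_sqrt {f g : ℕ × Ω → ℝ} (hf : MulTendstoZero (probFilter P) f)
    (hg : MulTendstoZero (probFilter P) g) :
    Tendsto (fun q => f q * g q / √(q.1 : ℝ)) (probFilter P) (𝓝 0) :=
  (hf _ (hg _ tendsto_inv_sqrt_probFilter)).congr fun q => by ring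

lemma tendsto_div_of_tendsto_div_sqrt {f : ℕ × Ω → ℝ}
    (hf : Tendsto (fun q => f q / √(q.1 : ℝ)) (probFilter P) (𝓝 0)) :
    Tendsto (fun q => f q / (q.1 : ℝ)) (probFilter P) (𝓝 0) := by
  have := hf.mul tendsto_inv_sqrt_probFilter
  rw [mul_zero] at this
  refine this.congr fun q => ?_
  rw [← div_eq_mul_inv, div_div, Real.mul_self_sqrt (Nat.cast_nonneg _)]

/-- The law of large numbers for the empirical second moments of the process. -/
lemma tendsto_empirical_moments [IsFiniteMeasure P] {θ ρ σ : ℝ} (hθ : |θ| < 1) (hρ : |ρ| < 1)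
    {x u : ℕ → Ω → ℝ}
    (hx : ∀ k ω, x (k + 2) ω = (θ + ρ) * x (k + 1) ω - θ * ρ * x k ω + u (k + 1) ω)
    (mx : ∀ k, AEMeasurable (x k) P) (mu : ∀ k, AEMeasurable (u k) P)
    (bx : MulTendstoZero (probFilter P) fun q => x q.1 q.2)
    (bx' : MulTendstoZero (probFilter P) fun q => x (q.1 - 1) q.2)
    (bM : MulTendstoZero (probFilter P) fun q =>
      (∑ k ∈ Finset.range q.1, x k q.2 * u k q.2) / √(q.1 : ℝ))
    (bN : MulTendstoZero (probFilter P) fun q =>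
      (∑ k ∈ Finset.range q.1, x (k - 1) q.2 * u k q.2) / √(q.1 : ℝ))
    (hu : Tendsto (fun q : ℕ × Ω => (∑ k ∈ Finset.range q.1, u k q.2 ^ 2) / (q.1 : ℝ))
      (probFilter P) (𝓝 (σ ^ 2))) :
    Tendsto (fun q : ℕ × Ω => (∑ k ∈ Finset.range q.1, x k q.2 ^ 2) / (q.1 : ℝ))
      (probFilter P) (𝓝 (statVar θ ρ σ)) ∧
    Tendsto (fun q : ℕ × Ω => (∑ k ∈ Finset.range q.1, x (k + 1) q.2 * x k q.2) / (q.1 : ℝ))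
      (probFilter P) (𝓝 (thetaStar θ ρ * statVar θ ρ σ)) := by
  have h1 : ∀ᶠ q : ℕ × Ω in probFilter P, 1 ≤ q.1 :=
    tendsto_fst_probFilter.eventually_ge_atTop 1
  have hmart : ∀ {f : ℕ × Ω → ℝ}, MulTendstoZero (probFilter P) (fun q => f q / √(q.1 : ℝ)) →
      Tendsto (fun q => f q / (q.1 : ℝ)) (probFilter P) (𝓝 0) := by
    intro f hf
    refine (hf _ tendsto_inv_sqrt_probFilter).congr fun q => ?_
    rw [← div_eq_mul_inv, div_div, Real.mul_self_sqrt (Nat.cast_nonneg _)]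
  have he := tendsto_div_of_tendsto_div_sqrt (tendsto_mul_div_sqrt bx bx')
  have he' : Tendsto (fun q : ℕ × Ω => x q.1 q.2 ^ 2 / (q.1 : ℝ)) (probFilter P) (𝓝 0) :=
    (tendsto_div_of_tendsto_div_sqrt (tendsto_mul_div_sqrt bx bx)).congr fun q => by
      rw [pow_two]
  have he'' : Tendsto (fun q : ℕ × Ω => x (q.1 - 1) q.2 ^ 2 / (q.1 : ℝ)) (probFilter P)
      (𝓝 0) :=
    (tendsto_div_of_tendsto_div_sqrt (tendsto_mul_div_sqrt bx' bx')).congr fun q => by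
      rw [pow_two]
  have hc₀ := tendsto_div_of_tendsto_div_sqrt (tendsto_const_div_sqrt (P := P)
    (Y := fun ω => x 1 ω * x 0 ω - (θ + ρ) * x 0 ω ^ 2 - x 0 ω * u 0 ω) (by fun_prop))
  have hc₂ := tendsto_div_of_tendsto_div_sqrt (tendsto_const_div_sqrt (P := P)
    (Y := fun ω => (1 - (θ + ρ) ^ 2) * x 0 ω ^ 2 - u 0 ω ^ 2
      - 2 * (θ + ρ) * (x 0 ω * u 0 ω) + 2 * (θ * ρ) * (x 0 ω * u 0 ω) + x 1 ω ^ 2)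
    (by fun_prop))
  have hST := h1.mono fun q hq => sum_mul_succ_identity (x := fun k => x k q.2)
    (u := fun k => u k q.2) (fun k => hx k q.2) hq
  have hE := h1.mono fun q hq => sum_sq_identity (x := fun k => x k q.2)
    (u := fun k => u k q.2) (fun k => hx k q.2) hq
  exact tendsto_second_moment hθ hρ rfl rfl hST hE hu (hmart bM) (hmart bN) he he' hc₀ he'' hc₂

/-- The sum of squares of a combination of consecutive values, up to boundary terms. -/
lemma sum_sq_comb_eq {z : ℕ → ℝ} (hz : z 0 = 0) (c₁ c₂ : ℝ) {n : ℕ} (hn : 1 ≤ n) :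
    ∑ k ∈ Finset.range n, (c₁ * z k + c₂ * z (k - 1)) ^ 2 =
      (c₁ ^ 2 + c₂ ^ 2) * ∑ k ∈ Finset.range n, z k ^ 2 +
        2 * c₁ * c₂ * (∑ k ∈ Finset.range n, z (k + 1) * z k - z n * z (n - 1)) -
        c₂ ^ 2 * z (n - 1) ^ 2 := by
  induction n, hn using Nat.le_induction with
  | base => simp [hz]
  | succ n hn ih =>
    obtain ⟨m, rfl⟩ : ∃ m, n = m + 1 := ⟨n - 1, by omega⟩
    rw [Finset.sum_range_succ, Finset.sum_range_succ _ (m + 1), Finset.sum_range_succ _ (m + 1)]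
    simp only [Nat.add_sub_cancel] at ih ⊢
    linear_combination ih

lemma tendsto_sum_sq_innovation [IsProbabilityMeasure P] {U : ℕ → Ω → ℝ}
    (hU : ∀ k, Measurable (U k)) (hind : iIndepFun U P)
    (hid : ∀ k, IdentDistrib (U k) (U 0) P P) (h4 : MemLp (U 0) 4 P) :
    Tendsto (fun q : ℕ × Ω => (∑ k ∈ Finset.range q.1, U k q.2 ^ 2) / (q.1 : ℝ))
      (probFilter P) (𝓝 (∫ ω, U 0 ω ^ 2 ∂P)) := by
  refine tendsto_probFilter_of_ae (f := fun n ω => (∑ k ∈ Finset.range n, U k ω ^ 2) / (n : ℝ))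
    (fun n => Measurable.aemeasurable (by fun_prop)) ?_
  refine strong_law_ae_real (fun k ω => U k ω ^ 2) ?_ (fun i j hij => ?_)
    fun k => (hid k).comp (u := fun x => x ^ 2) (by fun_prop)
  · simpa using integrable_pow_of_memLp_four h4 (j := 2) (by norm_num)
  · exact (hind.indepFun hij).comp (φ := fun x => x ^ 2) (ψ := fun x => x ^ 2)
      (by fun_prop) (by fun_prop)

/-- The process started from `0`, its shift and the two martingale sums built from them (the
latter divided by `√n`) are bounded in probability. -/
lemma mulTendstoZero_arZero [IsProbabilityMeasure P] {θ ρ : ℝ} (hθ : |θ| < 1)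
    (hρ : |ρ| < 1) {U : ℕ → Ω → ℝ} (hU : ∀ k, Measurable (U k)) (hind : iIndepFun U P)
    (hid : ∀ k, IdentDistrib (U k) (U 0) P P) (h4 : MemLp (U 0) 4 P)
    (h0 : ∫ ω, U 0 ω ∂P = 0) :
    (MulTendstoZero (probFilter P) fun q => arZero θ ρ (fun j => U j q.2) q.1) ∧
    (MulTendstoZero (probFilter P) fun q => arZero θ ρ (fun j => U j q.2) (q.1 - 1)) ∧
    (MulTendstoZero (probFilter P) fun q =>
      (∑ k ∈ Finset.range q.1, arZero θ ρ (fun j => U j q.2) k * U k q.2) / √(q.1 : ℝ)) ∧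
    MulTendstoZero (probFilter P) fun q =>
      (∑ k ∈ Finset.range q.1, arZero θ ρ (fun j => U j q.2) (k - 1) * U k q.2) /
        √(q.1 : ℝ) := by
  have hinn := isInnovation_of_iIndepFun hU hind hid h4 h0
  have h : ∀ c₁ c₂, (MulTendstoZero (probFilter P) fun q => arComb θ ρ c₁ c₂ U q.1 q.2) ∧
      MulTendstoZero (probFilter P) fun q =>
        (∑ k ∈ Finset.range q.1, arComb θ ρ c₁ c₂ U k q.2 * U k q.2) / √(q.1 : ℝ) := by
    intro c₁ c₂
    obtain ⟨L, hL⟩ := exists_memLp_arComb (P := P) hθ hρ hU hid h4 c₁ c₂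
    refine ⟨BddInProb.mulTendstoZero (bddInProb_of_integral_sq_le
      (fun n => (hL n).1.mono_exponent (by norm_num)) (C := 1 + L)
      fun n => (integral_pow_two_le (hL n).1).trans (by linarith [(hL n).2])), ?_⟩
    exact (bddInProb_sum_div_sqrt hinn (measurable_arComb hinn.measurable c₁ c₂)
      (fun k => (hL k).1) fun k => (hL k).2).mulTendstoZero
  have h10 := h 1 0
  have h01 := h 0 1
  simp only [arComb, one_mul, zero_mul, add_zero, zero_add] at h10 h01
  exact ⟨h10.1, h01.1, h10.2, h01.2⟩

/-- Central limit theorem for the martingale part of the process started from `0`. -/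
theorem tendsto_integral_exp_arComb [IsProbabilityMeasure P] {θ ρ σ : ℝ} (hθ : |θ| < 1)
    (hρ : |ρ| < 1) (hσ : 0 < σ) {U : ℕ → Ω → ℝ}
    (hU : ∀ k, Measurable (U k)) (hind : iIndepFun U P)
    (hid : ∀ k, IdentDistrib (U k) (U 0) P P) (h4 : MemLp (U 0) 4 P)
    (h0 : ∫ ω, U 0 ω ∂P = 0) (h2 : ∫ ω, U 0 ω ^ 2 ∂P = σ ^ 2) (c₁ c₂ : ℝ) :
    Tendsto (fun n : ℕ => ∫ ω, Complex.exp (Complex.I *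
      (((∑ k ∈ Finset.range n, arComb θ ρ c₁ c₂ U k ω * U k ω) / √n : ℝ) : ℂ)) ∂P) atTop
      (𝓝 (Real.exp (-(σ ^ 2 * (statVar θ ρ σ * (c₁ ^ 2 + 2 * c₁ * c₂ * thetaStar θ ρ + c₂ ^ 2))
        / 2)) : ℝ)) := by
  have hinn := isInnovation_of_iIndepFun hU hind hid h4 h0
  rw [h2] at hinn
  have hs := statVar_pos hσ hθ hρ
  set z : ℕ → Ω → ℝ := fun k ω => arZero θ ρ (fun j => U j ω) k with hz
  have mz : ∀ k, Measurable (z k) := fun k =>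
    (measurable_arZero hinn.measurable k).mono ((strictPast hU).le _) le_rfl
  obtain ⟨bz, bz', bM, bN⟩ := mulTendstoZero_arZero hθ hρ hU hind hid h4 h0
  obtain ⟨hS, hT⟩ := tendsto_empirical_moments (P := P) hθ hρ (σ := σ) (x := z) (u := U)
    (fun k ω => arZero_rec θ ρ _ k) (fun k => (mz k).aemeasurable)
    (fun k => (hU k).aemeasurable) bz bz' bM bN
    (h2 ▸ tendsto_sum_sq_innovation hU hind hid h4)
  obtain ⟨L, hL⟩ := exists_memLp_arComb (P := P) hθ hρ hU hid h4 c₁ c₂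
  refine tendsto_integral_exp_predictable hinn (measurable_arComb hinn.measurable c₁ c₂)
    (fun k => (hL k).1) (fun k => (hL k).2) ?_ ?_
  · have h3 := one_sub_thetaStar_sq hθ hρ
    have h4 : 0 ≤ 1 - thetaStar θ ρ ^ 2 := by
      rw [h3]
      have := one_sub_sq_pos hθ
      have := one_sub_sq_pos hρ
      positivity
    refine mul_nonneg hs.le ?_
    nlinarith [sq_nonneg (c₁ + c₂ * thetaStar θ ρ), mul_nonneg h4 (sq_nonneg c₂)]
  · have he := tendsto_div_of_tendsto_div_sqrt (tendsto_mul_div_sqrt bz bz')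
    have he' := tendsto_div_of_tendsto_div_sqrt (tendsto_mul_div_sqrt bz' bz')
    have h := ((hS.const_mul (c₁ ^ 2 + c₂ ^ 2)).add ((hT.sub he).const_mul (2 * c₁ * c₂))).sub
      (he'.const_mul (c₂ ^ 2))
    have e0 : (c₁ ^ 2 + c₂ ^ 2) * statVar θ ρ σ +
        2 * c₁ * c₂ * (thetaStar θ ρ * statVar θ ρ σ - 0) - c₂ ^ 2 * 0 =
        statVar θ ρ σ * (c₁ ^ 2 + 2 * c₁ * c₂ * thetaStar θ ρ + c₂ ^ 2) := by ring
    rw [e0] at h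
    refine h.congr' ?_
    filter_upwards [tendsto_fst_probFilter.eventually_ge_atTop 1] with q hq
    have := sum_sq_comb_eq (z := fun k => z k q.2) (by simp [hz, arZero, linRec]) c₁ c₂ hq
    have e : ∑ k ∈ Finset.range q.1, arComb θ ρ c₁ c₂ U k q.2 ^ 2 =
        ∑ k ∈ Finset.range q.1, (c₁ * z k q.2 + c₂ * z (k - 1) q.2) ^ 2 := rfl
    rw [e, this]
    ring

/-- Holds because the expectation of the sum is finite. -/
lemma ae_summable_geometric_mul {U : ℕ → Ω → ℝ} [IsProbabilityMeasure P]
    (hU : ∀ k, Measurable (U k))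
    (hid : ∀ k, IdentDistrib (U k) (U 0) P P) (h4 : MemLp (U 0) 4 P) {q : ℝ} (hq0 : 0 < q)
    (hq1 : q < 1) : ∀ᵐ ω ∂P, Summable fun k => q ^ k * |U k ω| := by
  have hint : Integrable (U 0) P := h4.integrable (by norm_num)
  have hfin : ∫⁻ ω, ∑' k, ENNReal.ofReal (q ^ k * |U k ω|) ∂P ≠ ⊤ := by
    rw [lintegral_tsum fun k => (by fun_prop)]
    have e : ∀ k, ∫⁻ ω, ENNReal.ofReal (q ^ k * |U k ω|) ∂P =
        ENNReal.ofReal (q ^ k) * ∫⁻ ω, ‖U 0 ω‖ₑ ∂P := by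
      intro k
      have h1 := ((hid k).comp (u := fun x => ‖x‖ₑ) (by fun_prop)).lintegral_eq
      rw [← lintegral_const_mul _ (by fun_prop)]
      calc ∫⁻ ω, ENNReal.ofReal (q ^ k * |U k ω|) ∂P
          = ENNReal.ofReal (q ^ k) * ∫⁻ ω, ‖U k ω‖ₑ ∂P := by
            rw [← lintegral_const_mul _ (by fun_prop)]
            refine lintegral_congr fun ω => ?_
            rw [ENNReal.ofReal_mul (by positivity), Real.enorm_eq_ofReal_abs]
        _ = _ := by
            rw [lintegral_const_mul _ (by fun_prop)]
            congr 1
    simp_rw [e]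
    rw [ENNReal.tsum_mul_right]
    refine ENNReal.mul_ne_top ?_ hint.2.ne
    exact (summable_geometric_of_lt_one hq0.le hq1).tsum_ofReal_ne_top
  filter_upwards [ae_lt_top' (by fun_prop) hfin] with ω hω
  have := ENNReal.summable_toReal hω.ne
  refine this.congr fun k => ?_
  rw [ENNReal.toReal_ofReal (by positivity)]

end Autoregression

/-! ### The limiting covariance and the linear part -/


lemma tendsto_sum_div_sqrt_of_geometric {d u : ℕ → ℝ} {C q : ℝ}
    (hd : ∀ k, |d k| ≤ C * q ^ k) (hs : Summable fun k => q ^ k * |u k|) :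
    Tendsto (fun n : ℕ => (∑ k ∈ Finset.range n, d k * u k) / √(n : ℝ)) atTop (𝓝 0) := by
  have hsum : Summable fun k => d k * u k := by
    refine Summable.of_norm_bounded (hs.mul_left C) fun k => ?_
    rw [Real.norm_eq_abs, abs_mul, ← mul_assoc]
    exact mul_le_mul_of_nonneg_right (hd k) (abs_nonneg _)
  exact hsum.hasSum.tendsto_sum_nat.div_atTop
    (Real.tendsto_sqrt_atTop.comp tendsto_natCast_atTop_atTop)

section Covariance

variable {θ ρ σ : ℝ}

lemma varTheta_eq (hσ : 0 < σ) (hθ : |θ| < 1) (hρ : |ρ| < 1) :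
    σ ^ 2 / ((1 + θ * ρ) ^ 2 * statVar θ ρ σ) = varTheta θ ρ := by
  have h1 := (one_add_mul_pos hθ hρ).ne'
  have h2 := (one_sub_mul_pos hθ hρ).ne'
  have h3 := (one_sub_sq_pos hθ).ne'
  have h4 := (one_sub_sq_pos hρ).ne'
  unfold varTheta statVar
  field_simp

/-- The second summand is the part of the limiting variance of `rhoHat` explained by
`thetaHat`. -/
lemma varRho_eq (hθ : |θ| < 1) (hρ : |ρ| < 1) :
    varRho θ ρ = (1 - θ * ρ) / (1 + θ * ρ) * (θ + ρ) ^ 2 + (θ * ρ) ^ 2 * varTheta θ ρ := by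
  have h1 := (one_add_mul_pos hθ hρ).ne'
  unfold varTheta varRho
  field_simp

lemma varTheta_nonneg (hθ : |θ| < 1) (hρ : |ρ| < 1) : 0 ≤ varTheta θ ρ := by
  have h1 := one_add_mul_pos hθ hρ
  have h2 := one_sub_mul_pos hθ hρ
  have h3 := one_sub_sq_pos hθ
  have h4 := one_sub_sq_pos hρ
  unfold varTheta
  positivity

/-- The quadratic form of `Gam` as a sum of two squares. -/
lemma dotProduct_Gam (hθ : |θ| < 1) (hρ : |ρ| < 1) (t : Fin 2 → ℝ) :
    t ⬝ᵥ (Gam θ ρ).mulVec t = varTheta θ ρ * (t 0 + θ * ρ * t 1) ^ 2 +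
      (1 - θ * ρ) / (1 + θ * ρ) * (θ + ρ) ^ 2 * t 1 ^ 2 := by
  simp only [Gam, Matrix.mulVec, dotProduct, Fin.sum_univ_two, Matrix.of_apply,
    Matrix.cons_val_zero, Matrix.cons_val_one, varRho_eq hθ hρ, Matrix.cons_val',
    Matrix.cons_val_fin_one]
  ring

lemma Gam_posSemidef (hθ : |θ| < 1) (hρ : |ρ| < 1) : (Gam θ ρ).PosSemidef := by
  refine Matrix.PosSemidef.of_dotProduct_mulVec_nonneg ?_ fun t => ?_
  · ext i j
    fin_cases i <;> fin_cases j <;> simp [Gam]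
  · rw [star_trivial, dotProduct_Gam hθ hρ]
    have h1 := one_add_mul_pos hθ hρ
    have h2 := one_sub_mul_pos hθ hρ
    have h3 := varTheta_nonneg hθ hρ
    positivity

/-- The variance produced by the central limit theorem, for the linear combination of the
martingale parts which approximates `t 0 * thetaHat + t 1 * rhoHat`, is the quadratic form
of `Gam`. -/
lemma limit_variance_eq (hσ : 0 < σ) (hθ : |θ| < 1) (hρ : |ρ| < 1) (t : Fin 2 → ℝ) {c₁ c₂ : ℝ}
    (hc₁ : c₁ = t 0 * ((1 + θ * ρ) * statVar θ ρ σ)⁻¹ + t 1 * ((thetaStar θ ρ ^ 2 + θ * ρ) /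
      ((1 + θ * ρ) * (statVar θ ρ σ * (1 - thetaStar θ ρ ^ 2)))))
    (hc₂ : c₂ = -(t 1 * (thetaStar θ ρ / (statVar θ ρ σ * (1 - thetaStar θ ρ ^ 2))))) :
    σ ^ 2 * (statVar θ ρ σ * (c₁ ^ 2 + 2 * c₁ * c₂ * thetaStar θ ρ + c₂ ^ 2)) =
      t ⬝ᵥ (Gam θ ρ).mulVec t := by
  have h1 := (one_add_mul_pos hθ hρ).ne'
  have h2 := (one_sub_mul_pos hθ hρ).ne'
  have h3 := (one_sub_sq_pos hθ).ne'
  have h4 := (one_sub_sq_pos hρ).ne'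
  have hs := (statVar_pos hσ hθ hρ).ne'
  have hts := one_sub_thetaStar_sq hθ hρ
  have h5 : 1 - thetaStar θ ρ ^ 2 ≠ 0 := by
    rw [hts]; exact div_ne_zero (mul_ne_zero h3 h4) (pow_ne_zero _ h1)
  -- `N - thetaStar * M` is asymptotically uncorrelated with `M`, hence `c₁ * M + c₂ * N` is
  -- rewritten in terms of these two
  have e1 : c₁ = (t 0 + θ * ρ * t 1) / ((1 + θ * ρ) * statVar θ ρ σ) - c₂ * thetaStar θ ρ := by
    rw [hc₁, hc₂]
    field_simp
    ring
  have e2 : c₁ ^ 2 + 2 * c₁ * c₂ * thetaStar θ ρ + c₂ ^ 2 =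
      ((t 0 + θ * ρ * t 1) / ((1 + θ * ρ) * statVar θ ρ σ)) ^ 2 +
        c₂ ^ 2 * (1 - thetaStar θ ρ ^ 2) := by
    rw [e1]; ring
  rw [e2, dotProduct_Gam hθ hρ, ← varTheta_eq hσ hθ hρ, mul_add, mul_add]
  congr 1
  · field_simp
  · have e3 : σ ^ 2 * (statVar θ ρ σ * (c₂ ^ 2 * (1 - thetaStar θ ρ ^ 2))) =
        t 1 ^ 2 * thetaStar θ ρ ^ 2 * (σ ^ 2 / (statVar θ ρ σ * (1 - thetaStar θ ρ ^ 2))) := by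
      rw [hc₂]; field_simp
    have e4 : σ ^ 2 / (statVar θ ρ σ * (1 - thetaStar θ ρ ^ 2)) =
        (1 - θ * ρ) * (1 + θ * ρ) := by
      rw [hts, statVar]; field_simp
    rw [e3, e4, ← thetaStar_mul hθ hρ]
    field_simp

end Covariance

section Measurability

variable {Ω : Type*} [MeasurableSpace Ω] {P : Measure Ω} {X : ℕ → Ω → ℝ}

lemma aemeasurable_thetaHat (hX : ∀ k, AEMeasurable (X k) P) (n : ℕ) :
    AEMeasurable (fun ω => thetaHat (fun k => X k ω) n) P := by
  unfold thetaHat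
  fun_prop

lemma aemeasurable_residual (hX : ∀ k, AEMeasurable (X k) P) (n k : ℕ) :
    AEMeasurable (fun ω => residual (fun k => X k ω) n k) P := by
  have := aemeasurable_thetaHat hX n
  unfold residual
  split_ifs
  · exact hX 0
  · fun_prop

lemma aemeasurable_rhoHat (hX : ∀ k, AEMeasurable (X k) P) (n : ℕ) :
    AEMeasurable (fun ω => rhoHat (fun k => X k ω) n) P := by
  have := aemeasurable_residual hX n
  unfold rhoHat
  fun_prop

end Measurability

section Main

lemma sum_arComb_eq {Ω : Type*} (θ ρ c₁ c₂ : ℝ) (U : ℕ → Ω → ℝ) (n : ℕ) (ω : Ω) :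
    ∑ k ∈ Finset.range n, arComb θ ρ c₁ c₂ U k ω * U k ω =
      c₁ * ∑ k ∈ Finset.range n, arComb θ ρ 1 0 U k ω * U k ω +
      c₂ * ∑ k ∈ Finset.range n, arComb θ ρ 0 1 U k ω * U k ω := by
  rw [Finset.mul_sum, Finset.mul_sum, ← Finset.sum_add_distrib]
  refine Finset.sum_congr rfl fun k _ => ?_
  simp only [arComb]
  ring

variable {Ω : Type*} [MeasurableSpace Ω] {P : Measure Ω} [IsProbabilityMeasure P]

/-- The first order approximation of the rescaled estimation errors, in terms of the process
started from `0`. -/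
def linearPart (θ ρ σ : ℝ) (U : ℕ → Ω → ℝ) (n : ℕ) (ω : Ω) : EuclideanSpace ℝ (Fin 2) :=
  !₂[(∑ k ∈ Finset.range n, arComb θ ρ 1 0 U k ω * U k ω) / √(n : ℝ) *
      ((1 + θ * ρ) * statVar θ ρ σ)⁻¹,
    (∑ k ∈ Finset.range n, arComb θ ρ 1 0 U k ω * U k ω) / √(n : ℝ) *
      ((thetaStar θ ρ ^ 2 + θ * ρ) /
        ((1 + θ * ρ) * (statVar θ ρ σ * (1 - thetaStar θ ρ ^ 2)))) -
    (∑ k ∈ Finset.range n, arComb θ ρ 0 1 U k ω * U k ω) / √(n : ℝ) *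
      (thetaStar θ ρ / (statVar θ ρ σ * (1 - thetaStar θ ρ ^ 2)))]

/-- Each linear form in the linear part is a single martingale sum, to which the central limit
theorem applies. -/
theorem tendstoInDistribution_linearPart {θ ρ σ : ℝ} (hθ : |θ| < 1)
    (hρ : |ρ| < 1) (hσ : 0 < σ) {U : ℕ → Ω → ℝ}
    (hU : ∀ k, Measurable (U k)) (hind : iIndepFun U P)
    (hid : ∀ k, IdentDistrib (U k) (U 0) P P) (h4 : MemLp (U 0) 4 P)
    (h0 : ∫ ω, U 0 ω ∂P = 0) (h2 : ∫ ω, U 0 ω ^ 2 ∂P = σ ^ 2) :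
    TendstoInDistribution (linearPart θ ρ σ U) atTop
      (id : EuclideanSpace ℝ (Fin 2) → EuclideanSpace ℝ (Fin 2))
      (fun _ => P) (multivariateGaussian 0 (Gam θ ρ)) := by
  have mc : ∀ c₁ c₂ k, Measurable (arComb θ ρ c₁ c₂ U k) := fun c₁ c₂ k =>
    (measurable_arComb (𝓖 := strictPast hU)
      (isInnovation_of_iIndepFun hU hind hid h4 h0).measurable c₁ c₂ k).mono
        ((strictPast hU).le k) le_rfl
  have mB : ∀ n, Measurable (linearPart θ ρ σ U n) := by
    intro n
    unfold linearPart
    refine (MeasurableEquiv.toLp 2 (Fin 2 → ℝ)).measurable.comp ?_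
    rw [measurable_pi_iff]
    intro i
    fin_cases i <;> simp <;> fun_prop
  refine ⟨fun n => (mB n).aemeasurable, aemeasurable_id, ?_⟩
  refine ProbabilityMeasure.tendsto_iff_tendsto_charFun.2 fun t => ?_
  simp only [ProbabilityMeasure.coe_mk, Measure.map_id]
  rw [charFun_multivariateGaussian (Gam_posSemidef hθ hρ)]
  set c₁ := t 0 * ((1 + θ * ρ) * statVar θ ρ σ)⁻¹ + t 1 * ((thetaStar θ ρ ^ 2 + θ * ρ) /
      ((1 + θ * ρ) * (statVar θ ρ σ * (1 - thetaStar θ ρ ^ 2)))) with hc₁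
  set c₂ := -(t 1 * (thetaStar θ ρ / (statVar θ ρ σ * (1 - thetaStar θ ρ ^ 2)))) with hc₂
  have h := tendsto_integral_exp_arComb hθ hρ hσ hU hind hid h4 h0 h2 c₁ c₂
  rw [limit_variance_eq hσ hθ hρ t hc₁ hc₂] at h
  convert h using 2 with n
  · rw [charFun_apply, integral_map (mB n).aemeasurable (by fun_prop)]
    refine integral_congr_ae (ae_of_all _ fun ω => ?_)
    simp only
    rw [mul_comm, sum_arComb_eq, linearPart]
    congr 3
    rw [hc₁, hc₂]
    generalize ((1 + θ * ρ) * statVar θ ρ σ)⁻¹ = w₀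
    generalize (thetaStar θ ρ ^ 2 + θ * ρ) /
      ((1 + θ * ρ) * (statVar θ ρ σ * (1 - thetaStar θ ρ ^ 2))) = w₁
    generalize thetaStar θ ρ / (statVar θ ρ σ * (1 - thetaStar θ ρ ^ 2)) = w₂
    simp only [PiLp.inner_apply, Fin.sum_univ_two, RCLike.inner_apply, conj_trivial,
      Matrix.cons_val_zero, Matrix.cons_val_one]
    ring
  · simp

end Main

/-! ### Arbitrary initial values -/


section Errors

variable {Ω : Type*} [MeasurableSpace Ω] {P : Measure Ω} [IsProbabilityMeasure P]

/-- The rescaled estimation errors differ from their linear parts by a term which tends to `0` in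
probability, whatever the initial values are. -/
theorem tendsto_estimators_sub_linearPart {θ ρ σ : ℝ} (hθ : |θ| < 1) (hρ : |ρ| < 1) (hσ : 0 < σ)
    {X ε V : ℕ → Ω → ℝ} (mX : ∀ k, AEMeasurable (X k) P)
    (hX : ∀ n ω, X (n + 1) ω = θ * X n ω + ε (n + 1) ω)
    (hε : ∀ n ω, ε (n + 1) ω = ρ * ε n ω + V (n + 1) ω)
    {U : ℕ → Ω → ℝ} (hUV : ∀ᵐ ω ∂P, ∀ n, V (n + 1) ω = U n ω)
    (hU : ∀ k, Measurable (U k)) (hind : iIndepFun U P)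
    (hid : ∀ k, IdentDistrib (U k) (U 0) P P) (h4 : MemLp (U 0) 4 P)
    (h0 : ∫ ω, U 0 ω ∂P = 0) (h2 : ∫ ω, U 0 ω ^ 2 ∂P = σ ^ 2) :
    Tendsto (fun q : ℕ × Ω =>
      √(q.1 : ℝ) * (thetaHat (fun k => X k q.2) q.1 - thetaStar θ ρ) -
        linearPart θ ρ σ U q.1 q.2 0) (probFilter P) (𝓝 0) ∧
    Tendsto (fun q : ℕ × Ω =>
      √(q.1 : ℝ) * (rhoHat (fun k => X k q.2) q.1 - rhoStar θ ρ) -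
        linearPart θ ρ σ U q.1 q.2 1) (probFilter P) (𝓝 0) := by
  have hinn := isInnovation_of_iIndepFun hU hind hid h4 h0
  set z : ℕ → Ω → ℝ := fun k ω => arZero θ ρ (fun j => U j ω) k with hz
  have mz : ∀ k, Measurable (z k) := fun k =>
    (measurable_arZero hinn.measurable k).mono ((strictPast hU).le _) le_rfl
  obtain ⟨bz, bz', bMz, bNz⟩ := mulTendstoZero_arZero (P := P) hθ hρ hU hind hid h4 h0
  -- almost surely, the initial values are forgotten geometrically fast
  obtain ⟨q, hq1, hq2⟩ := exists_between (max_lt hθ hρ)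
  obtain ⟨hqθ, hqρ⟩ := max_lt_iff.1 hq1
  have hq0 : 0 < q := (abs_nonneg _).trans_lt hqθ
  have mV : ∀ k, AEMeasurable (V (k + 1)) P := fun k =>
    (hU k).aemeasurable.congr (hUV.mono fun ω hω => (hω k).symm)
  have hdec : ∀ᵐ ω ∂P, ∃ C : ℝ, (∀ k, |X k ω - z k ω| ≤ C * q ^ k) ∧
      ∀ k, |X (k - 1) ω - z (k - 1) ω| ≤ C * q ^ k := by
    filter_upwards [hUV] with ω hω
    set C := |X 0 ω| + |ε 0 ω| / (1 - |θ| / q) with hC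
    have hb : ∀ k, |X k ω - z k ω| ≤ C * q ^ k := fun k =>
      abs_sub_arZero_le (x := fun k => X k ω) (e := fun k => ε k ω) (u := fun k => U k ω)
        hqθ hqρ (fun n => hX n ω) (fun n => by rw [← hω]; exact hε n ω) k
    have hC0 : 0 ≤ C := by simpa using (abs_nonneg _).trans (hb 0)
    -- dividing by `q` covers the shifted index, also at `k = 0`, where `k - 1 = 0`
    have hCq : C ≤ C / q := by
      rw [le_div_iff₀ hq0]; exact mul_le_of_le_one_right hC0 hq2.le
    refine ⟨C / q, fun k => (hb k).trans (by gcongr), fun k => (hb (k - 1)).trans ?_⟩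
    rcases k with _ | k
    · simpa using hCq
    · simp only [Nat.add_sub_cancel]
      rw [pow_succ]
      apply le_of_eq
      field_simp
  have hpow : Tendsto (fun n : ℕ => q ^ n) atTop (𝓝 0) :=
    tendsto_pow_atTop_nhds_zero_of_lt_one hq0.le hq2
  have hd : Tendsto (fun p : ℕ × Ω => X p.1 p.2 - z p.1 p.2) (probFilter P) (𝓝 0) := by
    refine tendsto_probFilter_of_ae (f := fun n ω => X n ω - z n ω)
      (fun n => (mX n).sub (mz n).aemeasurable) ?_
    filter_upwards [hdec] with ω ⟨C, h, _⟩
    exact squeeze_zero_norm h (by simpa using hpow.const_mul C)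
  have hd' : Tendsto (fun p : ℕ × Ω => X (p.1 - 1) p.2 - z (p.1 - 1) p.2)
      (probFilter P) (𝓝 0) := by
    refine tendsto_probFilter_of_ae (f := fun n ω => X (n - 1) ω - z (n - 1) ω)
      (fun n => (mX (n - 1)).sub (mz (n - 1)).aemeasurable) ?_
    filter_upwards [hdec] with ω ⟨C, _, h⟩
    exact squeeze_zero_norm h (by simpa using hpow.const_mul C)
  have hsumm := ae_summable_geometric_mul (P := P) hU hid h4 hq0 hq2
  have hMd : Tendsto (fun p : ℕ × Ω =>
      (∑ k ∈ Finset.range p.1, X k p.2 * V (k + 1) p.2) / √(p.1 : ℝ) -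
        (∑ k ∈ Finset.range p.1, z k p.2 * U k p.2) / √(p.1 : ℝ)) (probFilter P) (𝓝 0) := by
    refine tendsto_probFilter_of_ae (f := fun n ω =>
      (∑ k ∈ Finset.range n, X k ω * V (k + 1) ω) / √(n : ℝ) -
        (∑ k ∈ Finset.range n, z k ω * U k ω) / √(n : ℝ)) (fun n => by fun_prop) ?_
    filter_upwards [hdec, hUV, hsumm] with ω ⟨C, h, _⟩ hω hs
    refine (tendsto_sum_div_sqrt_of_geometric h hs).congr fun n => ?_
    rw [← sub_div, ← Finset.sum_sub_distrib]
    congr 1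
    exact Finset.sum_congr rfl fun k _ => by rw [hω]; ring
  have hNd : Tendsto (fun p : ℕ × Ω =>
      (∑ k ∈ Finset.range p.1, X (k - 1) p.2 * V (k + 1) p.2) / √(p.1 : ℝ) -
        (∑ k ∈ Finset.range p.1, z (k - 1) p.2 * U k p.2) / √(p.1 : ℝ))
      (probFilter P) (𝓝 0) := by
    refine tendsto_probFilter_of_ae (f := fun n ω =>
      (∑ k ∈ Finset.range n, X (k - 1) ω * V (k + 1) ω) / √(n : ℝ) -
        (∑ k ∈ Finset.range n, z (k - 1) ω * U k ω) / √(n : ℝ)) (fun n => by fun_prop) ?_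
    filter_upwards [hdec, hUV, hsumm] with ω ⟨C, _, h⟩ hω hs
    refine (tendsto_sum_div_sqrt_of_geometric h hs).congr fun n => ?_
    rw [← sub_div, ← Finset.sum_sub_distrib]
    congr 1
    exact Finset.sum_congr rfl fun k _ => by rw [hω]; ring
  have bX := bz.of_tendsto_sub hd
  have bX' := bz'.of_tendsto_sub hd'
  have bM := bMz.of_tendsto_sub hMd
  have bN := bNz.of_tendsto_sub hNd
  have hrec : ∀ k ω, X (k + 2) ω =
      (θ + ρ) * X (k + 1) ω - θ * ρ * X k ω + V (k + 2) ω := by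
    intro k ω
    have h1 := hX k ω
    have h2 := hX (k + 1) ω
    have h3 := hε (k + 1) ω
    linear_combination h2 + h3 - ρ * h1
  have hVsq : Tendsto (fun p : ℕ × Ω => (∑ k ∈ Finset.range p.1, V (k + 1) p.2 ^ 2) / (p.1 : ℝ))
      (probFilter P) (𝓝 (σ ^ 2)) := by
    refine (h2 ▸ tendsto_sum_sq_innovation hU hind hid h4).congr' ?_
    filter_upwards [eventually_probFilter_of_ae hUV] with p hp
    congr 1
    exact Finset.sum_congr rfl fun k _ => by rw [hp k]
  have hST : Tendsto (fun q : ℕ × Ω => (∑ k ∈ Finset.range q.1, X k q.2 ^ 2) / (q.1 : ℝ))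
      (probFilter P) (𝓝 (statVar θ ρ σ)) :=
    (tendsto_empirical_moments hθ hρ (u := fun k => V (k + 1)) hrec mX mV bX bX' bM bN hVsq).1
  have hge : ∀ᶠ p : ℕ × Ω in probFilter P, 1 ≤ p.1 :=
    tendsto_fst_probFilter.eventually_ge_atTop 1
  have hT1 := hge.mono fun p hp => sum_mul_succ_identity (x := fun k => X k p.2)
    (u := fun k => V (k + 1) p.2) (fun k => hrec k p.2) hp
  have hr0 : ∀ p : ℕ × Ω, residual (fun k => X k p.2) p.1 0 = X 0 p.2 := fun p => by
    simp [residual]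
  have hrs : ∀ (p : ℕ × Ω) k, residual (fun k => X k p.2) p.1 (k + 1) =
      X (k + 1) p.2 - thetaHat (fun k => X k p.2) p.1 * X k p.2 := fun p k => by
    simp [residual]
  have hJ := hge.mono fun p hp => sum_residual_mul_identity (x := fun k => X k p.2)
    (u := fun k => V (k + 1) p.2) (fun k => hrec k p.2) (hr0 p) (hrs p) hp
  have hD := hge.mono fun p hp => sum_residual_sq_identity (x := fun k => X k p.2)
    (hr0 p) (hrs p) hp
  have he := tendsto_mul_div_sqrt bX bX'
  have he' : Tendsto (fun p : ℕ × Ω => X (p.1 - 1) p.2 ^ 2 / √(p.1 : ℝ)) (probFilter P)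
      (𝓝 0) := (tendsto_mul_div_sqrt bX' bX').congr fun p => by rw [pow_two]
  have hc₀ := tendsto_const_div_sqrt (P := P) (Y := fun ω =>
    X 1 ω * X 0 ω - (θ + ρ) * X 0 ω ^ 2 - X 0 ω * V (0 + 1) ω) (by fun_prop)
  have hc₁ := tendsto_const_div_sqrt (P := P) (Y := fun ω => X 0 ω * V (0 + 1) ω) (by fun_prop)
  have hts1 : 0 < 1 - thetaStar θ ρ ^ 2 := by
    rw [one_sub_thetaStar_sq hθ hρ]
    have := one_sub_sq_pos hθ
    have := one_sub_sq_pos hρ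
    have := one_add_mul_pos hθ hρ
    positivity
  obtain ⟨hθhat, hρhat⟩ := tendsto_estimators_sub (one_add_mul_pos hθ hρ) (thetaStar_mul hθ hρ)
    hts1 (statVar_pos hσ hθ hρ) (r := fun p : ℕ × Ω => √(p.1 : ℝ))
    (hge.mono fun p hp => Real.sqrt_pos.2 (by exact_mod_cast hp)) tendsto_inv_sqrt_probFilter
    hT1 (hST.congr fun p => by rw [Real.sq_sqrt (Nat.cast_nonneg _)]) bM bN he he' hc₀ hc₁
    (fun p => thetaHat_eq (fun k => X k p.2) p.1) hJ hD
  constructor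
  · have h := hθhat.add (hMd.mul_const ((1 + θ * ρ) * statVar θ ρ σ)⁻¹)
    rw [zero_mul, add_zero] at h
    refine h.congr fun p => ?_
    simp only [linearPart, arComb, one_mul, zero_mul, add_zero, hz, Matrix.cons_val_zero]
    ring
  · have h := hρhat.add ((hMd.mul_const ((thetaStar θ ρ ^ 2 + θ * ρ) /
        ((1 + θ * ρ) * (statVar θ ρ σ * (1 - thetaStar θ ρ ^ 2))))).sub
      (hNd.mul_const (thetaStar θ ρ / (statVar θ ρ σ * (1 - thetaStar θ ρ ^ 2)))))
    rw [zero_mul, zero_mul, sub_zero, add_zero] at h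
    refine h.congr fun p => ?_
    simp only [linearPart, arComb, one_mul, zero_mul, add_zero, zero_add, hz,
      Matrix.cons_val_one, Matrix.cons_val_fin_one, rhoHat_eq, rhoStar]
    ring

end Errors

end DurbinWatson

end

theorem theorem3p2
    {Ω : Type*} [MeasurableSpace Ω] (P : Measure Ω) [IsProbabilityMeasure P]
    (θ ρ σ : ℝ) (hθ : |θ| < 1) (hρ : |ρ| < 1) (hσ : 0 < σ)
    (X ε V : ℕ → Ω → ℝ)
    -- the initial values are arbitrary random variables
    (hX0 : AEMeasurable (X 0) P) (hε0 : AEMeasurable (ε 0) P)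
    -- the autoregressive process with autoregressive driven noise
    (hX : ∀ n ω, X (n + 1) ω = θ * X n ω + ε (n + 1) ω)
    (hε : ∀ n ω, ε (n + 1) ω = ρ * ε n ω + V (n + 1) ω)
    -- `V 1, V 2, …` are i.i.d., centered, with variance `σ ^ 2` and a finite fourth moment
    (hindep : iIndepFun (fun n : ℕ => V (n + 1)) P)
    (hident : ∀ n : ℕ, IdentDistrib (V (n + 1)) (V 1) P P)
    (hmean : ∫ ω, V 1 ω ∂P = 0)
    (hvar : variance (V 1) P = σ ^ 2)
    (hmom : MemLp (V 1) 4 P) :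
    (DurbinWatson.Gam θ ρ).PosSemidef ∧
    TendstoInDistribution
      (fun (n : ℕ) (ω : Ω) =>
        (!₂[√(n : ℝ) * (DurbinWatson.thetaHat (fun k => X k ω) n - DurbinWatson.thetaStar θ ρ),
            √(n : ℝ) * (DurbinWatson.rhoHat (fun k => X k ω) n - DurbinWatson.rhoStar θ ρ)] :
          EuclideanSpace ℝ (Fin 2)))
      atTop (id : EuclideanSpace ℝ (Fin 2) → EuclideanSpace ℝ (Fin 2))
      (fun _ => P) (multivariateGaussian 0 (DurbinWatson.Gam θ ρ)) ∧
    TendstoInDistribution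
      (fun (n : ℕ) (ω : Ω) =>
        √(n : ℝ) * (DurbinWatson.rhoHat (fun k => X k ω) n - DurbinWatson.rhoStar θ ρ))
      atTop (id : ℝ → ℝ)
      (fun _ => P) (gaussianReal 0 (DurbinWatson.varRho θ ρ).toNNReal) := by
  -- the innovations are only almost everywhere measurable: measurable versions are taken
  have hVm : ∀ n, AEMeasurable (V (n + 1)) P := fun n => (hident n).aemeasurable_fst
  set U : ℕ → Ω → ℝ := fun n => (hVm n).mk (V (n + 1)) with hUdef
  have hU : ∀ n, Measurable (U n) := fun n => (hVm n).measurable_mk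
  have hUV : ∀ n, V (n + 1) =ᵐ[P] U n := fun n => (hVm n).ae_eq_mk
  have hUid : ∀ n, IdentDistrib (U n) (U 0) P P := fun n =>
    ((IdentDistrib.of_ae_eq (hVm n) (hUV n)).symm.trans (hident n)).trans
      (IdentDistrib.of_ae_eq (hVm 0) (hUV 0))
  have hU4 : MemLp (U 0) 4 P := hmom.ae_eq (hUV 0)
  have hU0 : ∫ ω, U 0 ω ∂P = 0 := by rw [← integral_congr_ae (hUV 0)]; exact hmean
  have hU2 : ∫ ω, U 0 ω ^ 2 ∂P = σ ^ 2 := by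
    rw [← hvar, variance_of_integral_eq_zero (hVm 0) hmean]
    exact integral_congr_ae ((hUV 0).mono fun ω hω => by simp only [← hω, zero_add])
  have hUind : iIndepFun U P := hindep.congr hUV
  have hmε : ∀ n, AEMeasurable (ε n) P := by
    intro n
    induction n with
    | zero => exact hε0
    | succ n ih =>
      rw [show ε (n + 1) = fun ω => ρ * ε n ω + V (n + 1) ω from funext (hε n)]
      exact (ih.const_mul ρ).add (hVm n)
  have hmX : ∀ n, AEMeasurable (X n) P := by
    intro n
    induction n with
    | zero => exact hX0
    | succ n ih =>
      rw [show X (n + 1) = fun ω => θ * X n ω + ε (n + 1) ω from funext (hX n)]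
      exact (ih.const_mul θ).add (hmε (n + 1))
  have hΓ := DurbinWatson.Gam_posSemidef hθ hρ
  obtain ⟨h₁, h₂⟩ := DurbinWatson.tendsto_estimators_sub_linearPart hθ hρ hσ hmX hX hε
    (ae_all_iff.2 hUV) hU hUind hUid hU4 hU0 hU2
  have hjoint : TendstoInDistribution
      (fun (n : ℕ) (ω : Ω) =>
        (!₂[√(n : ℝ) * (DurbinWatson.thetaHat (fun k => X k ω) n - DurbinWatson.thetaStar θ ρ),
            √(n : ℝ) * (DurbinWatson.rhoHat (fun k => X k ω) n - DurbinWatson.rhoStar θ ρ)] :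
          EuclideanSpace ℝ (Fin 2)))
      atTop (id : EuclideanSpace ℝ (Fin 2) → EuclideanSpace ℝ (Fin 2))
      (fun _ => P) (multivariateGaussian 0 (DurbinWatson.Gam θ ρ)) := by
    refine tendstoInDistribution_of_tendstoInMeasure_sub _ _
      (DurbinWatson.tendstoInDistribution_linearPart hθ hρ hσ hU hUind hUid hU4 hU0 hU2) ?_
      fun n => ?_
    · refine DurbinWatson.tendsto_probFilter_iff.1 ?_
      have hcont : Tendsto (fun x : Fin 2 → ℝ => (WithLp.toLp 2 x : EuclideanSpace ℝ (Fin 2)))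
          (𝓝 0) (𝓝 0) := (PiLp.continuous_toLp 2 _).tendsto' _ _ rfl
      have hpi : Tendsto (fun q : ℕ × Ω =>
          ![√(q.1 : ℝ) * (DurbinWatson.thetaHat (fun k => X k q.2) q.1 -
              DurbinWatson.thetaStar θ ρ) - DurbinWatson.linearPart θ ρ σ U q.1 q.2 0,
            √(q.1 : ℝ) * (DurbinWatson.rhoHat (fun k => X k q.2) q.1 -
              DurbinWatson.rhoStar θ ρ) - DurbinWatson.linearPart θ ρ σ U q.1 q.2 1])
          (DurbinWatson.probFilter P) (𝓝 0) := by
        rw [tendsto_pi_nhds]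
        intro i
        fin_cases i
        · exact h₁
        · exact h₂
      refine (hcont.comp hpi).congr fun q => ?_
      ext i
      fin_cases i <;> rfl
    · have := DurbinWatson.aemeasurable_thetaHat hmX n
      have := DurbinWatson.aemeasurable_rhoHat hmX n
      refine (MeasurableEquiv.toLp 2 (Fin 2 → ℝ)).measurable.comp_aemeasurable ?_
      rw [aemeasurable_pi_iff]
      intro i
      fin_cases i <;> simp <;> fun_prop
  refine ⟨hΓ, hjoint, ?_⟩
  -- the last claim is the second marginal of the joint convergence
  have hmarg := hjoint.continuous_comp (g := fun x : EuclideanSpace ℝ (Fin 2) => x 1)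
    (by fun_prop)
  refine ⟨hmarg.forall_aemeasurable, aemeasurable_id, ?_⟩
  have hlim := hmarg.tendsto
  have hmap := (measurePreserving_eval_multivariateGaussian
    (μ := (0 : EuclideanSpace ℝ (Fin 2))) hΓ (i := 1)).map_eq
  have hlaw : (⟨(gaussianReal 0 (DurbinWatson.varRho θ ρ).toNNReal).map id,
      Measure.isProbabilityMeasure_map aemeasurable_id⟩ : ProbabilityMeasure ℝ) =
      ⟨_, Measure.isProbabilityMeasure_map hmarg.aemeasurable_limit⟩ := by
    refine Subtype.ext ?_
    simp only [Measure.map_id, Function.comp_id]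
    exact hmap.symm
  rw [hlaw]
  exact hlim
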